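/- Let $\mathbb H^3\subset\mathbb R^{3,1}$ be the hyperboloid model of hyperbolic 3-space, and let $\phi:S\to\mathbb H^3$ be a smooth immersed surface with smooth unit normal field $N$. Let $\mathbb L(\mathbb H^3)$ be the space of oriented geodesics of $\mathbb H^3$ with its canonical neutral Kähler metric $\mathbb G$; the geodesic through $x$ with unit tangent $y$ is represented by $x\wedge y\in\Lambda^2\mathbb R^{3,1}$, and $\mathbb G$ is, up to a constant factor, the restriction of the symmetric form on $\Lambda^2\mathbb R^{3,1}$ given by the exterior product. Suppose that * the oriented normal geodesics $\Sigma=\{\phi\wedge N\}$ of $S$ form a marginally trapped surface in $(\mathbb L(\mathbb H^3),\mathbb G)$: the metric induced on $\Sigma$ is non-degenerate (equivalently, $S$ has no umbilic points) and the mean curvature vector $\vec H$ of $\Sigma$ satisfies $\mathbb G(\vec H,\vec H)=0$ everywhere; * $S$ is a Weingarten surface: its principal curvatures $k_1,k_2$ are functionally dependent, that is, $dk_1\wedge dk_2=0$ on $S$. Then there is an open dense subset $W\subset S$ such that each connected component of $W$ either has a constant principal curvature or is a surface of revolution. If, moreover, $S$ is connected and real analytic (that is, $S$, $\phi$ and $N$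 are real analytic), then $S$ itself either has a constant principal curvature or is a surface of revolution. Here a (piece of a) surface is a surface of revolution if it is locally invariant under a non-trivial one-parameter group of rotations of $\mathbb H^3$, that is, of linear isometries of $\mathbb R^{3,1}$ that fix some two-dimensional subspace pointwise (this subspace may be Lorentzian, spacelike or degenerate: rotations of spherical, hyperbolic or parabolic type); locally invariant means that the orbit of each point of the piece stays in the piece for small times. -/

import Mathlib

open Set
open scoped Manifold ContDiff Topology

/-! ## Minkowski space, hyperbolic space and bivectors -/

/-- Minkowski space `ℝ^{3,1}`; the coordinate of index `0` is the time coordinate. -/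
abbrev Mink : Type := Fin 4 → ℝ

/-- The Lorentzian scalar product of `ℝ^{3,1}`. -/
def mink (x y : Mink) : ℝ := -(x 0 * y 0) + x 1 * y 1 + x 2 * y 2 + x 3 * y 3

/-- Hyperbolic 3-space: the upper sheet of the unit hyperboloid of `ℝ^{3,1}`. -/
def hyperbolicSpace : Set Mink := {x | mink x x = -1 ∧ 0 < x 0}

/-- The space `Λ²(ℝ^{3,1})` of bivectors, in the coordinates with respect to
`e₀∧e₁, e₀∧e₂, e₀∧e₃, e₁∧e₂, e₁∧e₃, e₂∧e₃`. -/
abbrev Bivector : Type := Fin 6 → ℝ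

/-- The bivector `x ∧ y`. -/
def wedge (x y : Mink) : Bivector :=
  ![x 0 * y 1 - x 1 * y 0, x 0 * y 2 - x 2 * y 0, x 0 * y 3 - x 3 * y 0,
    x 1 * y 2 - x 2 * y 1, x 1 * y 3 - x 3 * y 1, x 2 * y 3 - x 3 * y 2]

/-- The scalar product of bivectors induced by that of `ℝ^{3,1}`:
`⟨x ∧ y, z ∧ w⟩ = ⟨x, z⟩ ⟨y, w⟩ - ⟨x, w⟩ ⟨y, z⟩`. -/
def bivInner (α β : Bivector) : ℝ :=
  -(α 0 * β 0) - α 1 * β 1 - α 2 * β 2 + α 3 * β 3 + α 4 * β 4 + α 5 * β 5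

/-- The bilinear form of signature `(3,3)` on bivectors given by the exterior product,
`α ∧ β = neutral α β • (e₀ ∧ e₁ ∧ e₂ ∧ e₃)`. Its restriction to the tangent spaces of the space
of oriented geodesics (below) is the canonical neutral Kähler metric `𝔾`, normalized by
`𝔾(e₁ ∧ N - k₁ • φ ∧ e₁, e₂ ∧ N - k₂ • φ ∧ e₂) = k₂ - k₁` for positive orthonormal `φ, e₁, e₂, N`
(a constant factor plays no role for null vectors). -/
def neutral (α β : Bivector) : ℝ :=
  α 0 * β 5 + α 5 * β 0 - α 1 * β 4 - α 4 * β 1 + α 2 * β 3 + α 3 * β 2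

/-! ## The space of oriented geodesics -/

/-- The space `𝕃(ℍ³)` of oriented geodesics of `ℍ³`. The geodesic through `x ∈ ℍ³` with unit
tangent vector `y` is the intersection of `ℍ³` with the plane spanned by `x, y`, and is
represented by `x ∧ y`. These are the decomposable bivectors (`γ ∧ γ = 0`) of square `-1`, that is,
the oriented planes of signature `(1,1)`. -/
def geodesicSpace : Set Bivector := {γ | neutral γ γ = 0 ∧ bivInner γ γ = -1}

/-- The tangent space of `𝕃(ℍ³)` at `γ`: the kernel of the differentials of the two (independent)
equations that define `𝕃(ℍ³)`. -/
def geodesicTangent (γ : Bivector) : Set Bivector := {τ | neutral γ τ = 0 ∧ bivInner γ τ = 0}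

/-- The model space of surfaces. -/
abbrev Plane : Type := EuclideanSpace ℝ (Fin 2)

/-- The coordinate derivative `∂ᵢF` at `u`. -/
noncomputable def partialD (F : Plane → Bivector) (u : Plane) (i : Fin 2) : Bivector :=
  fderiv ℝ F u (EuclideanSpace.single i 1)

/-- The second coordinate derivative `∂ᵢ∂ⱼF` at `u`. -/
noncomputable def partialD2 (F : Plane → Bivector) (u : Plane) (i j : Fin 2) : Bivector :=
  fderiv ℝ (fun w => partialD F w j) u (EuclideanSpace.single i 1)

/-- The matrix of the metric induced from `𝔾` by the map `F`, in coordinates. -/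
noncomputable def inducedMetric (F : Plane → Bivector) (u : Plane) : Matrix (Fin 2) (Fin 2) ℝ :=
  Matrix.of fun i j => neutral (partialD F u i) (partialD F u j)

/-- `τ` is tangent to `𝕃(ℍ³)` and `𝔾`-normal to the surface parametrized by `F`. -/
def IsNormalVector (F : Plane → Bivector) (u : Plane) (τ : Bivector) : Prop :=
  τ ∈ geodesicTangent (F u) ∧ ∀ i, neutral τ (partialD F u i) = 0

/-- `h` is the mean curvature vector at `F u` of the surface in `(𝕃(ℍ³), 𝔾)` parametrized by `F`,
`h = ½ ∑ g^{ij} II(∂ᵢ, ∂ⱼ)`. As `𝔾` is induced by a constant form on the space of bivectors, the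
Levi-Civita covariant derivative of `𝔾` is the tangential part of the derivative in that space, so
`𝔾(II(∂ᵢ, ∂ⱼ), ν) = neutral (∂ᵢ∂ⱼF) ν` for normal vectors `ν`. If the induced metric is
non-degenerate, then there is exactly one such `h`. -/
def IsMeanCurvatureVector (F : Plane → Bivector) (u : Plane) (h : Bivector) : Prop :=
  IsNormalVector F u h ∧ ∀ ν, IsNormalVector F u ν →
    neutral h ν = 1 / 2 * ∑ i, ∑ j, (inducedMetric F u)⁻¹ i j * neutral (partialD2 F u i j) ν

/-! ## Surfaces -/

section Surfaces

variable {M : Type*} [TopologicalSpace M] [ChartedSpace Plane M]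

/-- A smooth map `Γ` from a surface to `𝕃(ℍ³)` defines a marginally trapped surface: the induced
metric is non-degenerate (in particular `Γ` is an immersion) and the mean curvature vector is null
at every point. -/
def IsMarginallyTrapped (Γ : M → Bivector) : Prop :=
  (∀ p, Γ p ∈ geodesicSpace) ∧
  ∀ e ∈ atlas Plane M, ∀ u ∈ e.target,
    (inducedMetric (Γ ∘ e.symm) u).det ≠ 0 ∧
    ∃ h, IsMeanCurvatureVector (Γ ∘ e.symm) u h ∧ neutral h h = 0

/-- The differential at `p` of a map from a surface to Minkowski space. -/
noncomputable def diffAt (f : M → Mink) (p : M) (v : TangentSpace (𝓡 2) p) : Mink :=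
  mfderiv (𝓡 2) 𝓘(ℝ, Mink) f p v

/-- `x` is a smooth immersion of a surface into `ℍ³`, and `N` a smooth unit normal vector field
along it (tangent to `ℍ³`). -/
structure IsOrientedSurface (x N : M → Mink) : Prop where
  smooth : ContMDiff (𝓡 2) 𝓘(ℝ, Mink) ∞ x
  mem : ∀ p, x p ∈ hyperbolicSpace
  immersion : ∀ p, Function.Injective (diffAt x p)
  smooth_normal : ContMDiff (𝓡 2) 𝓘(ℝ, Mink) ∞ N
  unit : ∀ p, mink (N p) (N p) = 1
  tangent : ∀ p, mink (x p) (N p) = 0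
  normal : ∀ p v, mink (diffAt x p v) (N p) = 0

/-- The oriented normal geodesics of the surface, as a map to `𝕃(ℍ³)`. -/
def normalGeodesics (x N : M → Mink) (p : M) : Bivector := wedge (x p) (N p)

/-- `κ` is a principal curvature at `p`: an eigenvalue of the shape operator `A`,
`dx (A v) = -dN v`. -/
def IsPrincipalCurvature (x N : M → Mink) (p : M) (κ : ℝ) : Prop :=
  ∃ v : TangentSpace (𝓡 2) p, v ≠ 0 ∧ diffAt N p v = -(κ • diffAt x p v)

/-- The smaller principal curvature. -/
noncomputable def minCurvature (x N : M → Mink) (p : M) : ℝ :=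
  sInf {κ | IsPrincipalCurvature x N p κ}

/-- The larger principal curvature. -/
noncomputable def maxCurvature (x N : M → Mink) (p : M) : ℝ :=
  sSup {κ | IsPrincipalCurvature x N p κ}

/-- The differential at `p` of a real function on a surface. -/
noncomputable def realDiffAt (k : M → ℝ) (p : M) (v : TangentSpace (𝓡 2) p) : ℝ :=
  mfderiv (𝓡 2) 𝓘(ℝ, ℝ) k p v

/-- A surface without umbilic points is a Weingarten surface if its principal curvatures are
functionally dependent, `dk₁ ∧ dk₂ = 0`. -/
def IsWeingarten (x N : M → Mink) : Prop :=
  ∀ (p : M) (v w : TangentSpace (𝓡 2) p),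
    realDiffAt (minCurvature x N) p v * realDiffAt (maxCurvature x N) p w =
      realDiffAt (minCurvature x N) p w * realDiffAt (maxCurvature x N) p v

/-- One number is a principal curvature at all points of `V`. (If `V` is connected and free of
umbilic points, one of the two principal curvature functions is then constant on `V`.) -/
def HasConstantPrincipalCurvature (x N : M → Mink) (V : Set M) : Prop :=
  ∃ c : ℝ, ∀ p ∈ V, IsPrincipalCurvature x N p c

/-- A non-trivial one-parameter group of linear isometries of `ℝ^{3,1}` (hence of isometries of
`ℍ³`) that fixes a two-dimensional subspace pointwise. The subspace is Lorentzian for rotations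
about a geodesic (spherical type), spacelike for translations along a geodesic (hyperbolic type),
and degenerate for parabolic isometries (parabolic type). -/
structure IsRotationGroup (R : ℝ → Mink →L[ℝ] Mink) : Prop where
  zero : R 0 = ContinuousLinearMap.id ℝ Mink
  add : ∀ s t, R (s + t) = (R s).comp (R t)
  continuous : Continuous R
  isometry : ∀ t v w, mink (R t v) (R t w) = mink v w
  nontrivial : ∃ t, R t ≠ ContinuousLinearMap.id ℝ Mink
  fixed : ∃ P : Submodule ℝ Mink, Module.finrank ℝ P = 2 ∧ ∀ t, ∀ v ∈ P, R t v = v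

/-- The part `V` of the surface is (an open piece of) a surface of revolution: for some group of
rotations, the orbit of each point of `V` runs in `V` for small times. -/
def IsSurfaceOfRevolution (x : M → Mink) (V : Set M) : Prop :=
  ∃ R : ℝ → Mink →L[ℝ] Mink, IsRotationGroup R ∧
    ∀ p ∈ V, ∃ ε > 0, ∃ σ : ℝ → M, σ 0 = p ∧ ContinuousOn σ (Ioo (-ε) ε) ∧
      ∀ t ∈ Ioo (-ε) ε, σ t ∈ V ∧ x (σ t) = R t (x p)

end Surfaces

/-! ## Linear algebra of Minkowski space -/

/-! Near a non-umbilic point take unit principal vector fields `v, w` with curvatures `k, l`, images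
`e = dX(v)`, `f = dX(w)`, and `a`, `b` the two geodesic curvatures (up to sign). Differentiating
orthonormality gives `∇_v e = X - a f + k N` and `∇_v f = a e`, the bracket is `[v, w] = a v - b w`,
and Codazzi reads `w(k) = a (l - k)`, `v(l) = b (k - l)`.

Marginal trapping. For `F = X ∧ N` the vectors `dF(v)`, `dF(w)` are null, so the trace defining the
mean curvature involves only the mixed second derivative of `F`. Exchanging `k` and `l` in `dF(v)`,
`dF(w)` yields a null basis of the normal plane. The components of `H` against it are, up to
non-zero factors, `v(l)` and `w(k)`, and `H` is null exactly when their product vanishes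
(`dirD_mul_dirD_eq_zero`). The Weingarten relation `v(k) w(l) = w(k) v(l)` then gives `v(k) w(l) =
0` as well.

Four cases. On a smaller open set one fixed factor of each product vanishes identically. Either both
derivatives of one curvature vanish, and it is locally constant, or both curvatures are constant
along the same family of curvature lines, say along `v`. In the latter case `b = 0` and `v(a) = 0`,
whence `∇_v ∇_v e` is a multiple of `e` and `∇_w e = 0`. The bivector `e ∧ ∇_v e` is therefore
constant along `v` and only rescaled along `w`: its line is locally constant (`axis_eventually`).
Its Killing field at `X` is `e`, so the one-parameter group generated by this fixed bivector has
orbits in the surface. The sign of `⟨∇_v e, ∇_v e⟩ = a² + k² - 1` decides the type of the rotation;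
the exponential treats all types at once.

Globalization. Each of the four alternatives says that some function (a curvature, or the line of
axes) is locally constant, and the four open loci have dense union. Shrinking them to disjoint open
sets puts each component into a single locus (`exists_dense_components`). For analytic surfaces,
both "`c` is a principal curvature" and "the Killing field of `β` is tangent" are analytic
equations, so they spread from an open set to the whole connected surface. -/

theorem mink_comm (x y : Mink) : mink x y = mink y x := by
  simp only [mink]; ring

theorem mink_add_left (x y z : Mink) : mink (x + y) z = mink x z + mink y z := by
  simp only [mink, Pi.add_apply]; ring

theorem mink_add_right (x y z : Mink) : mink x (y + z) = mink x y + mink x z := by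
  simp only [mink, Pi.add_apply]; ring

theorem mink_smul_left (c : ℝ) (x y : Mink) : mink (c • x) y = c * mink x y := by
  simp only [mink, Pi.smul_apply, smul_eq_mul]; ring

theorem mink_smul_right (c : ℝ) (x y : Mink) : mink x (c • y) = c * mink x y := by
  simp only [mink, Pi.smul_apply, smul_eq_mul]; ring

theorem mink_neg_left (x y : Mink) : mink (-x) y = -mink x y := by
  simp only [mink, Pi.neg_apply]; ring

theorem mink_neg_right (x y : Mink) : mink x (-y) = -mink x y := by
  simp only [mink, Pi.neg_apply]; ring

theorem mink_sub_left (x y z : Mink) : mink (x - y) z = mink x z - mink y z := by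
  simp only [mink, Pi.sub_apply]; ring

theorem mink_sub_right (x y z : Mink) : mink x (y - z) = mink x y - mink x z := by
  simp only [mink, Pi.sub_apply]; ring

theorem mink_zero_left (x : Mink) : mink 0 x = 0 := by simp [mink]

theorem mink_zero_right (x : Mink) : mink x 0 = 0 := by simp [mink]

/-- The scalar product as a continuous bilinear map. -/
noncomputable def minkB : Mink →L[ℝ] Mink →L[ℝ] ℝ :=
  (LinearMap.mk₂ ℝ mink mink_add_left mink_smul_left mink_add_right
    mink_smul_right).toContinuousBilinearMap

/-- The exterior product as a continuous bilinear map. -/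
noncomputable def wedgeB : Mink →L[ℝ] Mink →L[ℝ] Bivector :=
  (LinearMap.mk₂ ℝ wedge
    (fun a b c => by ext i; fin_cases i <;> simp [wedge] <;> ring)
    (fun a b c => by ext i; fin_cases i <;> simp [wedge] <;> ring)
    (fun a b c => by ext i; fin_cases i <;> simp [wedge] <;> ring)
    (fun a b c => by ext i; fin_cases i <;> simp [wedge] <;> ring)).toContinuousBilinearMap

theorem wedgeB_apply (x y : Mink) : wedgeB x y = wedge x y := rfl

theorem wedge_add_left (x y z : Mink) : wedge (x + y) z = wedge x z + wedge y z := by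
  simp [← wedgeB_apply]

theorem wedge_add_right (x y z : Mink) : wedge x (y + z) = wedge x y + wedge x z := by
  simp [← wedgeB_apply]

theorem wedge_smul_left (c : ℝ) (x y : Mink) : wedge (c • x) y = c • wedge x y := by
  simp [← wedgeB_apply]

theorem wedge_smul_right (c : ℝ) (x y : Mink) : wedge x (c • y) = c • wedge x y := by
  simp [← wedgeB_apply]

theorem wedge_neg_right (x y : Mink) : wedge x (-y) = -wedge x y := by
  simp [← wedgeB_apply]

theorem wedge_self (x : Mink) : wedge x x = 0 := by
  ext i; fin_cases i <;> simp [wedge] <;> ring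

theorem wedge_swap (x y : Mink) : wedge x y = -wedge y x := by
  ext i; fin_cases i <;> simp [wedge] <;> ring

/-- The form `neutral` as a continuous bilinear map. -/
noncomputable def neutralB : Bivector →L[ℝ] Bivector →L[ℝ] ℝ :=
  (LinearMap.mk₂ ℝ neutral
    (fun a b c => by simp [neutral]; ring)
    (fun a b c => by simp [neutral]; ring)
    (fun a b c => by simp [neutral]; ring)
    (fun a b c => by simp [neutral]; ring)).toContinuousBilinearMap

theorem neutralB_apply (x y : Bivector) : neutralB x y = neutral x y := rfl

theorem neutral_comm (x y : Bivector) : neutral x y = neutral y x := by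
  simp only [neutral]; ring

theorem neutral_add_left (x y z : Bivector) :
    neutral (x + y) z = neutral x z + neutral y z := by
  simp [← neutralB_apply]

theorem neutral_add_right (x y z : Bivector) :
    neutral x (y + z) = neutral x y + neutral x z := by
  simp [← neutralB_apply]

theorem neutral_sub_left (x y z : Bivector) :
    neutral (x - y) z = neutral x z - neutral y z := by
  simp [← neutralB_apply]

theorem neutral_sub_right (x y z : Bivector) :
    neutral x (y - z) = neutral x y - neutral x z := by
  simp [← neutralB_apply]

theorem neutral_smul_left (c : ℝ) (x y : Bivector) :
    neutral (c • x) y = c * neutral x y := by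
  simp [← neutralB_apply]

theorem neutral_smul_right (c : ℝ) (x y : Bivector) :
    neutral x (c • y) = c * neutral x y := by
  simp [← neutralB_apply]

theorem neutral_neg_right (x y : Bivector) : neutral x (-y) = -neutral x y := by
  simp [← neutralB_apply]

theorem bivInner_add_right (x y z : Bivector) :
    bivInner x (y + z) = bivInner x y + bivInner x z := by
  simp [bivInner]; ring

theorem bivInner_sub_right (x y z : Bivector) :
    bivInner x (y - z) = bivInner x y - bivInner x z := by
  simp [bivInner]; ring

theorem bivInner_smul_right (c : ℝ) (x y : Bivector) :
    bivInner x (c • y) = c * bivInner x y := by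
  simp [bivInner]; ring

theorem bivInner_wedge (a b c d : Mink) :
    bivInner (wedge a b) (wedge c d) = mink a c * mink b d - mink a d * mink b c := by
  simp [bivInner, wedge, mink]; ring

/-- A vector orthogonal to a timelike unit vector is spacelike. -/
theorem mink_self_pos {x y : Mink} (hx : mink x x = -1) (hxy : mink x y = 0) (hy : y ≠ 0) :
    0 < mink y y := by
  simp only [mink] at *
  by_contra hcon
  -- Cauchy–Schwarz for the spatial parts, through Lagrange's identity. If `y` were not spacelike,
  -- it would contradict the fact that the spatial part of `x` is shorter than its time component.
  have hcs : (x 1 * y 1 + x 2 * y 2 + x 3 * y 3) ^ 2 ≤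
      (x 1 ^ 2 + x 2 ^ 2 + x 3 ^ 2) * (y 1 ^ 2 + y 2 ^ 2 + y 3 ^ 2) := by
    nlinarith [sq_nonneg (x 1 * y 2 - x 2 * y 1), sq_nonneg (x 1 * y 3 - x 3 * y 1),
      sq_nonneg (x 2 * y 3 - x 3 * y 2)]
  have h0 : x 0 * y 0 = x 1 * y 1 + x 2 * y 2 + x 3 * y 3 := by linarith
  have h1 : x 1 ^ 2 + x 2 ^ 2 + x 3 ^ 2 = x 0 ^ 2 - 1 := by linarith
  rw [← h0, h1] at hcs
  have h3 : y 1 ^ 2 + y 2 ^ 2 + y 3 ^ 2 ≤ y 0 ^ 2 := by linarith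
  have hpos : 0 ≤ x 0 ^ 2 - 1 := by rw [← h1]; positivity
  have h4 : y 1 ^ 2 + y 2 ^ 2 + y 3 ^ 2 ≤ 0 := by nlinarith
  have h5 : y 0 ^ 2 ≤ 0 := by
    have : y 1 ^ 2 + y 2 ^ 2 + y 3 ^ 2 = 0 := le_antisymm h4 (by positivity)
    rw [this] at hcs
    nlinarith [sq_nonneg (y 0)]
  have e0 : y 0 = 0 := by nlinarith [sq_nonneg (y 0)]
  have e1 : y 1 = 0 := by nlinarith [sq_nonneg (y 1), sq_nonneg (y 2), sq_nonneg (y 3)]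
  have e2 : y 2 = 0 := by nlinarith [sq_nonneg (y 1), sq_nonneg (y 2), sq_nonneg (y 3)]
  have e3 : y 3 = 0 := by nlinarith [sq_nonneg (y 1), sq_nonneg (y 2), sq_nonneg (y 3)]
  apply hy
  ext i
  fin_cases i <;> simp [e0, e1, e2, e3]

/-- A vector orthogonal to `x`, to the unit normal `n` and to the tangent plane vanishes. -/
theorem eq_zero_of_orthogonal {x n s t z : Mink} (hxx : mink x x = -1) (hnn : mink n n = 1)
    (hxn : mink x n = 0) (hxs : mink x s = 0) (hxt : mink x t = 0) (hns : mink s n = 0)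
    (hnt : mink t n = 0) (hst : ∀ α β : ℝ, α • s + β • t = 0 → α = 0 ∧ β = 0)
    (zx : mink z x = 0) (zn : mink z n = 0) (zs : mink z s = 0) (zt : mink z t = 0) : z = 0 := by
  have hli : LinearIndependent ℝ ![x, n, s, t] := by
    rw [Fintype.linearIndependent_iff]
    intro g hg
    simp only [Fin.sum_univ_four, Matrix.cons_val_zero, Matrix.cons_val_one, Matrix.cons_val] at hg
    have h0 := congrArg (mink x) hg
    have h1 := congrArg (fun y => mink y n) hg
    simp only [mink_add_right, mink_smul_right, mink_add_left, mink_smul_left, mink_zero_left,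
      mink_zero_right, hxx, hxn, hxs, hxt, hnn, hns, hnt] at h0 h1
    have g0 : g 0 = 0 := by linarith
    have g1 : g 1 = 0 := by linarith
    rw [g0, g1] at hg
    obtain ⟨g2, g3⟩ := hst (g 2) (g 3) (by simpa using hg)
    intro i
    fin_cases i <;> assumption
  have hspan := hli.span_eq_top_of_card_eq_finrank (by simp)
  have key : ∀ y : Mink, mink z y = 0 := by
    intro y
    have hy : y ∈ Submodule.span ℝ (range ![x, n, s, t]) := by rw [hspan]; trivial
    induction hy using Submodule.span_induction with
    | mem y hy =>
      obtain ⟨i, rfl⟩ := hy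
      fin_cases i <;> simpa
    | zero => exact mink_zero_right z
    | add a b _ _ ha hb => rw [mink_add_right, ha, hb, add_zero]
    | smul c a _ ha => rw [mink_smul_right, ha, mul_zero]
  ext i
  have := key (Pi.single i 1)
  fin_cases i <;> simpa [mink] using this

/-- `x, e, f, n` is an orthonormal frame of Minkowski space with timelike vector `x`. -/
structure IsLorentzFrame (x e f n : Mink) : Prop where
  xx : mink x x = -1
  ee : mink e e = 1
  ff : mink f f = 1
  nn : mink n n = 1
  xe : mink x e = 0
  xf : mink x f = 0
  xn : mink x n = 0
  ef : mink e f = 0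
  en : mink e n = 0
  fn : mink f n = 0

namespace IsLorentzFrame

variable {x e f n : Mink}

theorem swap (h : IsLorentzFrame x e f n) : IsLorentzFrame x f e n :=
  ⟨h.xx, h.ff, h.ee, h.nn, h.xf, h.xe, h.xn, by rw [mink_comm, h.ef], h.fn, h.en⟩

theorem independent (h : IsLorentzFrame x e f n) (α β : ℝ) (hz : α • e + β • f = 0) :
    α = 0 ∧ β = 0 := by
  have h1 := congrArg (mink e) hz
  have h2 := congrArg (mink f) hz
  simp only [mink_add_right, mink_smul_right, h.ee, h.ff, h.ef, mink_comm f e,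
    mink_zero_right] at h1 h2
  constructor <;> linarith

theorem ext {y z : Mink} (h : IsLorentzFrame x e f n) (hx : mink y x = mink z x)
    (he : mink y e = mink z e) (hf : mink y f = mink z f) (hn : mink y n = mink z n) : y = z := by
  rw [← sub_eq_zero]
  apply eq_zero_of_orthogonal h.xx h.nn h.xn h.xe h.xf h.en h.fn h.independent <;>
    rw [mink_sub_left, sub_eq_zero] <;> assumption

theorem expand (h : IsLorentzFrame x e f n) (y : Mink) :
    y = -mink y x • x + mink y e • e + mink y f • f + mink y n • n := by
  apply h.ext <;>
    simp only [mink_add_left, mink_smul_left, h.xx, h.ee, h.ff, h.nn, h.xe, h.xf, h.xn, h.ef,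
      h.en, h.fn, mink_comm e x, mink_comm f x, mink_comm n x, mink_comm f e, mink_comm n e,
      mink_comm n f] <;> ring

/-- A linear form on bivectors vanishing on the bivectors of a frame vanishes. -/
theorem linear_eq_zero (h : IsLorentzFrame x e f n) (L : Bivector →ₗ[ℝ] ℝ)
    (hxe : L (wedge x e) = 0) (hxf : L (wedge x f) = 0) (hxn : L (wedge x n) = 0)
    (hef : L (wedge e f) = 0) (hen : L (wedge e n) = 0) (hfn : L (wedge f n) = 0)
    (β : Bivector) : L β = 0 := by
  have key : ∀ y z, L (wedge y z) = 0 := by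
    intro y z
    rw [h.expand y, h.expand z]
    simp only [wedge_add_left, wedge_add_right, wedge_smul_left, wedge_smul_right, wedge_self,
      wedge_swap e x, wedge_swap f x, wedge_swap n x, wedge_swap f e, wedge_swap n e,
      wedge_swap n f, map_add, map_smul, map_neg, hxe, hxf, hxn, hef, hen, hfn, map_zero,
      smul_zero, neg_zero, add_zero]
  have hβ : β = wedge (Pi.single 0 1) ![0, β 0, β 1, β 2] +
      wedge (Pi.single 1 1) ![0, 0, β 3, β 4] + wedge (Pi.single 2 1) ![0, 0, 0, β 5] := by
    ext i
    fin_cases i <;> simp [wedge]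
  rw [hβ, map_add, map_add, key, key, key]
  simp

end IsLorentzFrame

/-! ### Products of decomposable bivectors -/

theorem neutral_eq_zero_of_left {β : Bivector} (h : ∀ γ, neutral β γ = 0) : β = 0 := by
  ext i
  have h0 := h (Pi.single 0 1)
  have h1 := h (Pi.single 1 1)
  have h2 := h (Pi.single 2 1)
  have h3 := h (Pi.single 3 1)
  have h4 := h (Pi.single 4 1)
  have h5 := h (Pi.single 5 1)
  simp [neutral] at h0 h1 h2 h3 h4 h5
  fin_cases i <;> assumption

theorem neutral_wedge_swap_right (a b c d : Mink) :
    neutral (wedge a b) (wedge d c) = -neutral (wedge a b) (wedge c d) := by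
  rw [wedge_swap d, neutral_neg_right]

/-- The product of `a ∧ b` and `c ∧ d` is the determinant of `a, b, c, d`, hence alternating. These
identities reduce every product of bivectors of a frame to zero or to plus or minus the volume of
the frame. -/
theorem neutral_wedge_swap_mid (a b c d : Mink) :
    neutral (wedge a c) (wedge b d) = -neutral (wedge a b) (wedge c d) := by
  simp [neutral, wedge]; ring

theorem neutral_wedge_repeat₁₃ (a b d : Mink) : neutral (wedge a b) (wedge a d) = 0 := by
  simp [neutral, wedge]; ring

theorem neutral_wedge_repeat₁₄ (a b c : Mink) : neutral (wedge a b) (wedge c a) = 0 := by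
  simp [neutral, wedge]; ring

theorem neutral_wedge_repeat₂₃ (a b d : Mink) : neutral (wedge a b) (wedge b d) = 0 := by
  simp [neutral, wedge]; ring

theorem neutral_wedge_repeat₂₄ (a b c : Mink) : neutral (wedge a b) (wedge c b) = 0 := by
  simp [neutral, wedge]; ring

namespace IsLorentzFrame

variable {x e f n : Mink}

/-- The volume of an orthonormal frame does not vanish. -/
theorem volume_ne_zero (h : IsLorentzFrame x e f n) : neutral (wedge x e) (wedge f n) ≠ 0 := by
  intro h0
  have hzero : wedge x e = 0 := by
    apply neutral_eq_zero_of_left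
    apply h.linear_eq_zero (neutralB (wedge x e) : Bivector →ₗ[ℝ] ℝ) <;>
      simp only [ContinuousLinearMap.coe_coe, neutralB_apply, neutral_wedge_repeat₁₃,
        neutral_wedge_repeat₂₃, h0]
  have := bivInner_wedge x e x e
  rw [hzero, h.xx, h.ee, h.xe] at this
  simp [bivInner] at this

/-- A bivector tangent to the space of geodesics at `x ∧ n` is determined by its products with the
tangent frame. -/
theorem geodesicTangent_eq_zero (h : IsLorentzFrame x e f n) {τ : Bivector}
    (hτ : τ ∈ geodesicTangent (wedge x n)) (h1 : neutral τ (wedge e n) = 0)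
    (h2 : neutral τ (wedge f n) = 0) (h3 : neutral τ (wedge x e) = 0)
    (h4 : neutral τ (wedge x f) = 0) : τ = 0 := by
  have hv := h.volume_ne_zero
  set V := neutral (wedge x e) (wedge f n) with hV
  -- The Hodge dual of `x ∧ n` is a multiple of `e ∧ f`, so this combination of the two forms is
  -- identically zero. It turns the tangency condition on `bivInner` into the vanishing of the
  -- product with `e ∧ f`.
  let L : Bivector →ₗ[ℝ] ℝ :=
    { toFun := fun β => V * bivInner (wedge x n) β + neutral (wedge e f) β
      map_add' := fun a b => by rw [bivInner_add_right, neutral_add_right]; ring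
      map_smul' := fun c a => by
        rw [bivInner_smul_right, neutral_smul_right, RingHom.id_apply, smul_eq_mul]; ring }
  have hL : ∀ β, L β = 0 := by
    apply h.linear_eq_zero L <;>
      simp only [L, LinearMap.coe_mk, AddHom.coe_mk, bivInner_wedge, neutral_wedge_repeat₁₃,
        neutral_wedge_repeat₁₄, neutral_wedge_repeat₂₃, neutral_wedge_repeat₂₄, h.xx,
        h.nn, h.xe, h.xf, h.xn, h.en, h.fn, mink_comm n x, mink_comm n e, mink_comm n f]
    · ring
    · ring
    · rw [neutral_comm, neutral_wedge_swap_mid, neutral_wedge_swap_right, hV]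
      ring
    · ring
    · ring
    · ring
  apply neutral_eq_zero_of_left
  apply h.linear_eq_zero (neutralB τ : Bivector →ₗ[ℝ] ℝ) <;>
    simp only [ContinuousLinearMap.coe_coe, neutralB_apply]
  · exact h3
  · exact h4
  · rw [neutral_comm]; exact hτ.1
  · have := hL τ
    simp only [L, LinearMap.coe_mk, AddHom.coe_mk, hτ.2] at this
    rw [neutral_comm]; linarith
  · exact h1
  · exact h2

end IsLorentzFrame

/-- The interior product of a bivector with a vector; skew-adjoint in the vector. -/
def contract (β : Bivector) (y : Mink) : Mink :=
  ![-(β 0 * y 1) - β 1 * y 2 - β 2 * y 3,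
    -(β 0 * y 0) - β 3 * y 2 - β 4 * y 3,
    -(β 1 * y 0) + β 3 * y 1 - β 5 * y 3,
    -(β 2 * y 0) + β 4 * y 1 + β 5 * y 2]

/-- Exhibits the contraction with `a ∧ b` as the infinitesimal rotation in the plane of `a, b`: its
image lies in that plane and it kills the orthogonal complement. -/
theorem contract_wedge (a b y : Mink) :
    contract (wedge a b) y = mink y a • b - mink y b • a := by
  ext i
  fin_cases i <;> simp [contract, wedge, mink] <;> ring

theorem mink_contract (β : Bivector) (y z : Mink) :
    mink (contract β y) z = -mink y (contract β z) := by
  simp [contract, mink]; ring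

/-- The interior product with a bivector as a linear map. -/
noncomputable def contractL (β : Bivector) : Mink →L[ℝ] Mink :=
  LinearMap.toContinuousLinearMap
    { toFun := contract β
      map_add' := fun y z => by ext i; fin_cases i <;> simp [contract] <;> ring
      map_smul' := fun c y => by ext i; fin_cases i <;> simp [contract] <;> ring }

theorem contractL_apply (β : Bivector) (y : Mink) : contractL β y = contract β y := rfl

/-! ## Directional derivatives along vector fields of the plane -/

section DirectionalDerivative

variable {E F G : Type*} [NormedAddCommGroup E] [NormedSpace ℝ E] [NormedAddCommGroup F]
  [NormedSpace ℝ F] [NormedAddCommGroup G] [NormedSpace ℝ G] {U : Set Plane} {u : Plane}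

/-- The derivative of `f` along the vector field `v`. -/
noncomputable def dirD (v : Plane → Plane) (f : Plane → E) (u : Plane) : E := fderiv ℝ f u (v u)

theorem ContDiffOn.differentiableAt_of_isOpen {f : Plane → E} (hf : ContDiffOn ℝ ∞ f U)
    (hU : IsOpen U) (hu : u ∈ U) : DifferentiableAt ℝ f u :=
  (hf.contDiffAt (hU.mem_nhds hu)).differentiableAt (by simp)

theorem ContDiffOn.dirD {v : Plane → Plane} {f : Plane → E} (hf : ContDiffOn ℝ ∞ f U)
    (hv : ContDiffOn ℝ ∞ v U) (hU : IsOpen U) : ContDiffOn ℝ ∞ (dirD v f) U :=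
  (hf.fderiv_of_isOpen hU (m := ∞) (by simp)).clm_apply hv

theorem dirD_congr {f g : Plane → E} (hU : IsOpen U) (hfg : EqOn f g U) (hu : u ∈ U)
    (v : Plane → Plane) : dirD v f u = dirD v g u := by
  have : f =ᶠ[𝓝 u] g := hfg.eventuallyEq_of_mem (hU.mem_nhds hu)
  rw [dirD, dirD, this.fderiv_eq]

theorem dirD_eq_zero {f : Plane → E} {c : E} (hU : IsOpen U) (hf : ∀ p ∈ U, f p = c) (hu : u ∈ U)
    (v : Plane → Plane) : dirD v f u = 0 := by
  rw [dirD_congr hU (g := fun _ => c) hf hu, dirD]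
  simp

theorem dirD_bilin (B : E →L[ℝ] F →L[ℝ] G) {f : Plane → E} {g : Plane → F}
    (hf : DifferentiableAt ℝ f u) (hg : DifferentiableAt ℝ g u) (v : Plane → Plane) :
    dirD v (fun p => B (f p) (g p)) u = B (dirD v f u) (g u) + B (f u) (dirD v g u) := by
  rw [dirD, B.fderiv_of_bilinear hf hg]
  simp [dirD, add_comm]

theorem dirD_mink {f g : Plane → Mink} (hf : DifferentiableAt ℝ f u)
    (hg : DifferentiableAt ℝ g u) (v : Plane → Plane) :
    dirD v (fun p => mink (f p) (g p)) u = mink (dirD v f u) (g u) + mink (f u) (dirD v g u) :=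
  dirD_bilin minkB hf hg v

theorem dirD_wedge {f g : Plane → Mink} (hf : DifferentiableAt ℝ f u)
    (hg : DifferentiableAt ℝ g u) (v : Plane → Plane) :
    dirD v (fun p => wedge (f p) (g p)) u =
      wedge (dirD v f u) (g u) + wedge (f u) (dirD v g u) :=
  dirD_bilin wedgeB hf hg v

theorem dirD_smul {c : Plane → ℝ} {f : Plane → E} (hc : DifferentiableAt ℝ c u)
    (hf : DifferentiableAt ℝ f u) (v : Plane → Plane) :
    dirD v (fun p => c p • f p) u = dirD v c u • f u + c u • dirD v f u :=
  dirD_bilin (ContinuousLinearMap.lsmul ℝ ℝ) hc hf v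

theorem dirD_mul {c f : Plane → ℝ} (hc : DifferentiableAt ℝ c u)
    (hf : DifferentiableAt ℝ f u) (v : Plane → Plane) :
    dirD v (fun p => c p * f p) u = dirD v c u * f u + c u * dirD v f u :=
  dirD_smul hc hf v

theorem dirD_add {f g : Plane → E} (hf : DifferentiableAt ℝ f u)
    (hg : DifferentiableAt ℝ g u) (v : Plane → Plane) :
    dirD v (fun p => f p + g p) u = dirD v f u + dirD v g u := by
  rw [dirD, fderiv_fun_add hf hg]; rfl

theorem dirD_sub {f g : Plane → E} (hf : DifferentiableAt ℝ f u)
    (hg : DifferentiableAt ℝ g u) (v : Plane → Plane) :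
    dirD v (fun p => f p - g p) u = dirD v f u - dirD v g u := by
  rw [dirD, fderiv_fun_sub hf hg]; rfl

theorem dirD_neg (f : Plane → E) (v : Plane → Plane) :
    dirD v (fun p => -f p) u = -dirD v f u := by
  rw [dirD, fderiv_fun_neg]; rfl

theorem dirD_dirD {v w : Plane → Plane} {f : Plane → E} (hf : ContDiffOn ℝ ∞ f U)
    (hw : ContDiffOn ℝ ∞ w U) (hU : IsOpen U) (hu : u ∈ U) :
    dirD v (dirD w f) u = fderiv ℝ (fderiv ℝ f) u (v u) (w u) + fderiv ℝ f u (dirD v w u) := by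
  have hf' : DifferentiableAt ℝ (fderiv ℝ f) u :=
    (hf.fderiv_of_isOpen hU (m := ∞) (by simp)).differentiableAt_of_isOpen hU hu
  have hw' := hw.differentiableAt_of_isOpen hU hu
  change fderiv ℝ (fun p => fderiv ℝ f p (w p)) u (v u) = _
  rw [fderiv_clm_apply hf' hw']
  simp [dirD, add_comm]

theorem fderiv_fderiv_comm {f : Plane → E} (hf : ContDiffOn ℝ ∞ f U) (hU : IsOpen U) (hu : u ∈ U)
    (y z : Plane) : fderiv ℝ (fderiv ℝ f) u y z = fderiv ℝ (fderiv ℝ f) u z y :=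
  ((hf.contDiffAt (hU.mem_nhds hu)).isSymmSndFDerivAt
    (by rw [minSmoothness_of_isRCLikeNormedField]; exact WithTop.coe_le_coe.mpr le_top)) y z

/-- The Hessian terms cancel by symmetry, and what remains is the derivative along the Lie bracket
of the two fields. -/
theorem dirD_commutator {v w : Plane → Plane} {f : Plane → E} (hf : ContDiffOn ℝ ∞ f U)
    (hv : ContDiffOn ℝ ∞ v U) (hw : ContDiffOn ℝ ∞ w U) (hU : IsOpen U) (hu : u ∈ U) :
    dirD v (dirD w f) u - dirD w (dirD v f) u =
      fderiv ℝ f u (dirD v w u - dirD w v u) := by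
  rw [dirD_dirD hf hw hU hu, dirD_dirD hf hv hU hu, fderiv_fderiv_comm hf hU hu, map_sub]
  abel

theorem ContDiffOn.mink {f g : Plane → Mink} {n : ℕ∞ω} (hf : ContDiffOn ℝ n f U)
    (hg : ContDiffOn ℝ n g U) : ContDiffOn ℝ n (fun p => mink (f p) (g p)) U :=
  (minkB.contDiff.comp_contDiffOn hf).clm_apply hg

theorem ContDiffOn.wedge {f g : Plane → Mink} {n : ℕ∞ω} (hf : ContDiffOn ℝ n f U)
    (hg : ContDiffOn ℝ n g U) : ContDiffOn ℝ n (fun p => wedge (f p) (g p)) U :=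
  (wedgeB.contDiff.comp_contDiffOn hf).clm_apply hg

end DirectionalDerivative

/-! ## Principal frames -/

/-- Vector fields `v, w` on an open set of the plane whose images under the differential of the
surface `X` in hyperbolic space with unit normal `N` are orthonormal principal directions with
distinct principal curvatures `k, l`. -/
structure IsPrincipalFrame (X N : Plane → Mink) (k l : Plane → ℝ) (v w : Plane → Plane)
    (U : Set Plane) : Prop where
  isOpen : IsOpen U
  smooth_X : ContDiffOn ℝ ∞ X U
  smooth_N : ContDiffOn ℝ ∞ N U
  smooth_k : ContDiffOn ℝ ∞ k U
  smooth_l : ContDiffOn ℝ ∞ l U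
  smooth_v : ContDiffOn ℝ ∞ v U
  smooth_w : ContDiffOn ℝ ∞ w U
  xx : ∀ u ∈ U, mink (X u) (X u) = -1
  nn : ∀ u ∈ U, mink (N u) (N u) = 1
  xn : ∀ u ∈ U, mink (X u) (N u) = 0
  injective : ∀ u ∈ U, Function.Injective (fderiv ℝ X u)
  normal : ∀ u ∈ U, ∀ y, mink (fderiv ℝ X u y) (N u) = 0
  ee : ∀ u ∈ U, mink (dirD v X u) (dirD v X u) = 1
  ff : ∀ u ∈ U, mink (dirD w X u) (dirD w X u) = 1
  ef : ∀ u ∈ U, mink (dirD v X u) (dirD w X u) = 0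
  shape_v : ∀ u ∈ U, dirD v N u = -(k u • dirD v X u)
  shape_w : ∀ u ∈ U, dirD w N u = -(l u • dirD w X u)
  ne : ∀ u ∈ U, k u ≠ l u

theorem mink_fderiv_eq_zero {X : Plane → Mink} {U : Set Plane} {c : ℝ} (hU : IsOpen U)
    (hX : ContDiffOn ℝ ∞ X U) (hc : ∀ u ∈ U, mink (X u) (X u) = c) {u : Plane} (hu : u ∈ U)
    (y : Plane) : mink (X u) (fderiv ℝ X u y) = 0 := by
  have h := dirD_eq_zero hU hc hu (fun _ => y)
  have hd := hX.differentiableAt_of_isOpen hU hu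
  rw [dirD_mink hd hd, mink_comm] at h
  have h' : mink (X u) (dirD (fun _ => y) X u) = 0 := by linarith
  exact h'

namespace IsPrincipalFrame

variable {X N : Plane → Mink} {k l : Plane → ℝ} {v w : Plane → Plane} {U : Set Plane} {u : Plane}

theorem swap (h : IsPrincipalFrame X N k l v w U) : IsPrincipalFrame X N l k w v U where
  isOpen := h.isOpen
  smooth_X := h.smooth_X
  smooth_N := h.smooth_N
  smooth_k := h.smooth_l
  smooth_l := h.smooth_k
  smooth_v := h.smooth_w
  smooth_w := h.smooth_v
  xx := h.xx
  nn := h.nn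
  xn := h.xn
  injective := h.injective
  normal := h.normal
  ee := h.ff
  ff := h.ee
  ef := fun u hu => by rw [mink_comm, h.ef u hu]
  shape_v := h.shape_w
  shape_w := h.shape_v
  ne := fun u hu => (h.ne u hu).symm

theorem mono (h : IsPrincipalFrame X N k l v w U) {U' : Set Plane} (hU' : IsOpen U')
    (hUU' : U' ⊆ U) : IsPrincipalFrame X N k l v w U' where
  isOpen := hU'
  smooth_X := h.smooth_X.mono hUU'
  smooth_N := h.smooth_N.mono hUU'
  smooth_k := h.smooth_k.mono hUU'
  smooth_l := h.smooth_l.mono hUU'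
  smooth_v := h.smooth_v.mono hUU'
  smooth_w := h.smooth_w.mono hUU'
  xx := fun u hu => h.xx u (hUU' hu)
  nn := fun u hu => h.nn u (hUU' hu)
  xn := fun u hu => h.xn u (hUU' hu)
  injective := fun u hu => h.injective u (hUU' hu)
  normal := fun u hu => h.normal u (hUU' hu)
  ee := fun u hu => h.ee u (hUU' hu)
  ff := fun u hu => h.ff u (hUU' hu)
  ef := fun u hu => h.ef u (hUU' hu)
  shape_v := fun u hu => h.shape_v u (hUU' hu)
  shape_w := fun u hu => h.shape_w u (hUU' hu)
  ne := fun u hu => h.ne u (hUU' hu)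

theorem frame (h : IsPrincipalFrame X N k l v w U) (hu : u ∈ U) :
    IsLorentzFrame (X u) (dirD v X u) (dirD w X u) (N u) where
  xx := h.xx u hu
  ee := h.ee u hu
  ff := h.ff u hu
  nn := h.nn u hu
  xe := mink_fderiv_eq_zero h.isOpen h.smooth_X h.xx hu _
  xf := mink_fderiv_eq_zero h.isOpen h.smooth_X h.xx hu _
  xn := h.xn u hu
  ef := h.ef u hu
  en := h.normal u hu _
  fn := h.normal u hu _

theorem smooth_e (h : IsPrincipalFrame X N k l v w U) : ContDiffOn ℝ ∞ (dirD v X) U :=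
  h.smooth_X.dirD h.smooth_v h.isOpen

theorem diffAt_X (h : IsPrincipalFrame X N k l v w U) (hu : u ∈ U) : DifferentiableAt ℝ X u :=
  h.smooth_X.differentiableAt_of_isOpen h.isOpen hu

theorem diffAt_N (h : IsPrincipalFrame X N k l v w U) (hu : u ∈ U) : DifferentiableAt ℝ N u :=
  h.smooth_N.differentiableAt_of_isOpen h.isOpen hu

theorem diffAt_k (h : IsPrincipalFrame X N k l v w U) (hu : u ∈ U) : DifferentiableAt ℝ k u :=
  h.smooth_k.differentiableAt_of_isOpen h.isOpen hu

theorem diffAt_e (h : IsPrincipalFrame X N k l v w U) (hu : u ∈ U) :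
    DifferentiableAt ℝ (dirD v X) u :=
  h.smooth_e.differentiableAt_of_isOpen h.isOpen hu

/-- The vector fields `v, w` span the tangent plane. -/
theorem expand (h : IsPrincipalFrame X N k l v w U) (hu : u ∈ U) (y : Plane) :
    y = mink (fderiv ℝ X u y) (dirD v X u) • v u + mink (fderiv ℝ X u y) (dirD w X u) • w u := by
  apply h.injective u hu
  rw [map_add, map_smul, map_smul]
  conv_lhs => rw [(h.frame hu).expand (fderiv ℝ X u y)]
  rw [h.normal u hu, mink_comm _ (X u), mink_fderiv_eq_zero h.isOpen h.smooth_X h.xx hu]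
  simp [dirD]

/-- The geodesic curvature of the `v`-curves, up to sign. -/
noncomputable def geodCurv (X : Plane → Mink) (v w : Plane → Plane) (u : Plane) : ℝ :=
  mink (dirD v (dirD w X) u) (dirD v X u)

theorem smooth_geodCurv (h : IsPrincipalFrame X N k l v w U) :
    ContDiffOn ℝ ∞ (geodCurv X v w) U :=
  (h.swap.smooth_e.dirD h.smooth_v h.isOpen).mink h.smooth_e

/-- Each component comes from differentiating one of the orthogonality relations of `e`. The
coefficient of `X` is `1` because `X` is timelike and its derivative is `e`; that of `N` comes from
the shape operator. -/
theorem dirD_e_frame (h : IsPrincipalFrame X N k l v w U) (hu : u ∈ U) :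
    dirD v (dirD v X) u = X u - geodCurv X v w u • dirD w X u + k u • N u := by
  have hf := h.frame hu
  have de := h.diffAt_e hu
  have df := h.swap.diffAt_e hu
  have e1 := dirD_eq_zero h.isOpen (fun p hp => (h.frame hp).xe) hu v
  have e2 := dirD_eq_zero h.isOpen (fun p hp => (h.frame hp).ee) hu v
  have e3 := dirD_eq_zero h.isOpen (fun p hp => (h.frame hp).ef) hu v
  have e4 := dirD_eq_zero h.isOpen (fun p hp => (h.frame hp).en) hu v
  rw [dirD_mink (h.diffAt_X hu) de] at e1
  rw [dirD_mink de de] at e2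
  rw [dirD_mink de df] at e3
  rw [dirD_mink de (h.diffAt_N hu), h.shape_v u hu] at e4
  rw [mink_comm _ (dirD v (dirD v X) u)] at e1
  rw [mink_comm _ (dirD v (dirD v X) u)] at e2
  rw [mink_comm _ (dirD v (dirD w X) u)] at e3
  rw [mink_neg_right, mink_smul_right] at e4
  apply hf.ext <;>
    simp only [mink_add_left, mink_sub_left, mink_smul_left, hf.xx, hf.ee, hf.ff, hf.nn, hf.xe,
      hf.xf, hf.xn, hf.ef, hf.en, hf.fn, mink_comm (N u) (X u), mink_comm (N u) (dirD v X u),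
      mink_comm (N u) (dirD w X u), mink_comm (dirD w X u) (X u),
      mink_comm (dirD w X u) (dirD v X u), geodCurv] at e1 e2 e3 e4 ⊢ <;> linarith

/-- There is no component along `N` because principal directions diagonalize the second fundamental
form, and none along `X` because `e` and `f` are orthogonal. -/
theorem dirD_f_frame (h : IsPrincipalFrame X N k l v w U) (hu : u ∈ U) :
    dirD v (dirD w X) u = geodCurv X v w u • dirD v X u := by
  have hf := h.frame hu
  have de := h.diffAt_e hu
  have df := h.swap.diffAt_e hu
  have e1 := dirD_eq_zero h.isOpen (fun p hp => (h.frame hp).xf) hu v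
  have e2 := dirD_eq_zero h.isOpen (fun p hp => (h.frame hp).ff) hu v
  have e4 := dirD_eq_zero h.isOpen (fun p hp => (h.frame hp).fn) hu v
  rw [dirD_mink (h.diffAt_X hu) df] at e1
  rw [dirD_mink df df] at e2
  rw [dirD_mink df (h.diffAt_N hu), h.shape_v u hu] at e4
  rw [mink_comm _ (dirD v (dirD w X) u)] at e1
  rw [mink_comm _ (dirD v (dirD w X) u)] at e2
  rw [mink_neg_right, mink_smul_right] at e4
  apply hf.ext <;>
    simp only [mink_smul_left, hf.ee, hf.ef, hf.en, mink_comm (dirD w X u) (dirD v X u),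
      mink_comm (dirD v X u) (X u), hf.xe, geodCurv] at e1 e2 e4 ⊢ <;> linarith

/-- The bracket of the frame. -/
theorem commutator (h : IsPrincipalFrame X N k l v w U) (hu : u ∈ U) {E : Type*}
    [NormedAddCommGroup E] [NormedSpace ℝ E] {f : Plane → E} (hf : ContDiffOn ℝ ∞ f U) :
    dirD v (dirD w f) u - dirD w (dirD v f) u =
      geodCurv X v w u • dirD v f u - geodCurv X w v u • dirD w f u := by
  -- The bracket is found by applying both derivatives to `X` itself; injectivity of the
  -- differential of `X` then determines it in the plane.
  have key : dirD v w u - dirD w v u = geodCurv X v w u • v u - geodCurv X w v u • w u := by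
    apply h.injective u hu
    rw [← dirD_commutator h.smooth_X h.smooth_v h.smooth_w h.isOpen hu, h.dirD_f_frame hu,
      h.swap.dirD_f_frame hu, map_sub, map_smul, map_smul]
    rfl
  rw [dirD_commutator hf h.smooth_v h.smooth_w h.isOpen hu, key, map_sub, map_smul, map_smul]
  rfl

/-- This is the `e`-component of the bracket identity applied to `N`. -/
theorem codazzi (h : IsPrincipalFrame X N k l v w U) (hu : u ∈ U) :
    dirD w k u = geodCurv X v w u * (l u - k u) := by
  have hf := h.frame hu
  have hc := h.commutator hu h.smooth_N
  rw [dirD_congr h.isOpen h.shape_w hu, dirD_congr h.isOpen h.shape_v hu, h.shape_v u hu,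
    h.shape_w u hu, dirD_neg, dirD_neg, dirD_smul (h.swap.diffAt_k hu) (h.swap.diffAt_e hu),
    dirD_smul (h.diffAt_k hu) (h.diffAt_e hu), h.dirD_f_frame hu, h.swap.dirD_f_frame hu] at hc
  have he := congrArg (fun y => mink y (dirD v X u)) hc
  simp only [mink_add_left, mink_sub_left, mink_smul_left, mink_neg_left, hf.ee, hf.ef,
    mink_comm (dirD w X u) (dirD v X u)] at he
  linarith

/-! ### Frames with curvatures constant along one of the principal directions -/

/-- The bivector of the osculating planes of the `v`-curves. -/
noncomputable def axis (X : Plane → Mink) (v : Plane → Plane) (u : Plane) : Bivector :=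
  wedge (dirD v X u) (dirD v (dirD v X) u)

theorem geodCurv_eq_zero (h : IsPrincipalFrame X N k l v w U)
    (hl : ∀ p ∈ U, dirD v l p = 0) (hu : u ∈ U) : geodCurv X w v u = 0 := by
  have := h.swap.codazzi hu
  rw [hl u hu, eq_comm, mul_eq_zero, sub_eq_zero] at this
  exact this.resolve_right (h.ne u hu)

/-- The bracket identity applied to `k` reduces to `v(w(k)) = 0`. By Codazzi `w(k)` is `l - k` times
the geodesic curvature, and `l - k` is constant along `v` and non-zero. -/
theorem dirD_geodCurv (h : IsPrincipalFrame X N k l v w U) (hk : ∀ p ∈ U, dirD v k p = 0)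
    (hl : ∀ p ∈ U, dirD v l p = 0) (hu : u ∈ U) : dirD v (geodCurv X v w) u = 0 := by
  have hc := h.commutator hu h.smooth_k
  rw [dirD_eq_zero h.isOpen hk hu, hk u hu, h.geodCurv_eq_zero hl hu,
    dirD_congr h.isOpen (fun p hp => h.codazzi hp) hu,
    dirD_mul (h.smooth_geodCurv.differentiableAt_of_isOpen h.isOpen hu)
      ((h.swap.diffAt_k hu).fun_sub (h.diffAt_k hu)),
    dirD_sub (h.swap.diffAt_k hu) (h.diffAt_k hu), hk u hu, hl u hu] at hc
  have : l u - k u ≠ 0 := sub_ne_zero.mpr (h.ne u hu).symm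
  simpa [this] using hc

/-- All coefficients of `∇_v e = X - a f + k N` are constant along `v`, so `∇_v ∇_v e = (1 - a² -
k²) e`. The plane of `e` and `∇_v e` is thus parallel along the curvature line. -/
theorem dirD_axis_v (h : IsPrincipalFrame X N k l v w U) (hk : ∀ p ∈ U, dirD v k p = 0)
    (hl : ∀ p ∈ U, dirD v l p = 0) (hu : u ∈ U) : dirD v (axis X v) u = 0 := by
  have de := h.diffAt_e hu
  have df := h.swap.diffAt_e hu
  have da := h.smooth_geodCurv.differentiableAt_of_isOpen h.isOpen hu
  have d2 := (h.smooth_e.dirD h.smooth_v h.isOpen).differentiableAt_of_isOpen h.isOpen hu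
  have e1 : dirD v (dirD v (dirD v X)) u =
      (1 - geodCurv X v w u ^ 2 - k u ^ 2) • dirD v X u := by
    rw [dirD_congr h.isOpen (fun p hp => h.dirD_e_frame hp) hu,
      dirD_add ((h.diffAt_X hu).fun_sub (da.fun_smul df))
        ((h.diffAt_k hu).fun_smul (h.diffAt_N hu)),
      dirD_sub (h.diffAt_X hu) (da.fun_smul df), dirD_smul da df,
      dirD_smul (h.diffAt_k hu) (h.diffAt_N hu), h.dirD_geodCurv hk hl hu, hk u hu,
      h.dirD_f_frame hu, h.shape_v u hu]
    module
  change dirD v (fun p => wedge (dirD v X p) (dirD v (dirD v X) p)) u = 0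
  rw [dirD_wedge de d2, e1, wedge_self, wedge_smul_right, wedge_self, smul_zero, add_zero]

/-- The `w`-curves are geodesics of zero curvature `b`, so `e` is constant along them; the bracket
identity applied to `e` then gives `∇_w ∇_v e = -a ∇_v e`. -/
theorem dirD_axis_w (h : IsPrincipalFrame X N k l v w U)
    (hl : ∀ p ∈ U, dirD v l p = 0) (hu : u ∈ U) :
    dirD w (axis X v) u = -geodCurv X v w u • axis X v u := by
  have de := h.diffAt_e hu
  have d2 := (h.smooth_e.dirD h.smooth_v h.isOpen).differentiableAt_of_isOpen h.isOpen hu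
  have h0 : ∀ p ∈ U, dirD w (dirD v X) p = 0 := fun p hp => by
    rw [h.swap.dirD_f_frame hp, h.geodCurv_eq_zero hl hp, zero_smul]
  have hc := h.commutator hu h.smooth_e
  rw [dirD_eq_zero h.isOpen h0 hu, h0 u hu, smul_zero, sub_zero, zero_sub] at hc
  change dirD w (fun p => wedge (dirD v X p) (dirD v (dirD v X) p)) u = _
  rw [dirD_wedge de d2, h0 u hu, neg_eq_iff_eq_neg.mp hc, wedge_neg_right, wedge_smul_right,
    neg_smul, axis, ← wedgeB_apply, map_zero]
  simp

theorem smooth_axis (h : IsPrincipalFrame X N k l v w U) : ContDiffOn ℝ ∞ (axis X v) U :=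
  h.smooth_e.wedge (h.smooth_e.dirD h.smooth_v h.isOpen)

/-- Only the component of `∇_v e` along `X` contributes. Thus the Killing field of the axis is a
unit tangent vector at `X`, which shows both that the axis is non-zero and that its rotations move
the surface along itself. -/
theorem contract_axis (h : IsPrincipalFrame X N k l v w U) (hu : u ∈ U) :
    contract (axis X v u) (X u) = dirD v X u := by
  have hf := h.frame hu
  rw [axis, contract_wedge, hf.xe, h.dirD_e_frame hu, mink_add_right, mink_sub_right,
    mink_smul_right, mink_smul_right, hf.xx, hf.xf, hf.xn]
  simp

theorem axis_ne_zero (h : IsPrincipalFrame X N k l v w U) (hu : u ∈ U) : axis X v u ≠ 0 := by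
  intro h0
  have h1 := h.contract_axis hu
  have h2 := (h.frame hu).ee
  rw [← h1, h0] at h2
  simp [contract, mink] at h2

/-- The lines spanned by the bivectors `axis` are locally constant. -/
theorem axis_eventually (h : IsPrincipalFrame X N k l v w U) (hk : ∀ p ∈ U, dirD v k p = 0)
    (hl : ∀ p ∈ U, dirD v l p = 0) (hu : u ∈ U) :
    ∀ᶠ p in 𝓝 u, ∃ c : ℝ, c ≠ 0 ∧ axis X v p = c • axis X v u := by
  obtain ⟨i, hi⟩ : ∃ i, axis X v u i ≠ 0 := by
    by_contra! hcon
    exact h.axis_ne_zero hu (funext hcon)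
  -- Every derivative of the bivector is a multiple of the bivector: zero along `v`, proportional
  -- along `w`.
  have hder : ∀ p ∈ U, ∀ y, ∃ θ : ℝ, fderiv ℝ (axis X v) p y = θ • axis X v p := by
    intro p hp y
    refine ⟨mink (fderiv ℝ X p y) (dirD w X p) * -geodCurv X v w p, ?_⟩
    conv_lhs => rw [h.expand hp y, map_add, map_smul, map_smul]
    change _ • dirD v (axis X v) p + _ • dirD w (axis X v) p = _
    rw [h.dirD_axis_v hk hl hp, h.dirD_axis_w hl hp, smul_zero, zero_add, smul_smul]
  have hdiff : ∀ p ∈ U, DifferentiableAt ℝ (axis X v) p := fun p hp =>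
    h.smooth_axis.differentiableAt_of_isOpen h.isOpen hp
  have hcont : ContinuousAt (fun p => axis X v p i) u :=
    (continuous_apply i).continuousAt.comp (hdiff u hu).continuousAt
  obtain ⟨r, hr, hball⟩ := Metric.eventually_nhds_iff_ball.mp
    ((h.isOpen.eventually_mem hu).and (hcont.eventually_ne hi))
  -- Dividing by a coordinate that does not vanish nearby removes the scaling factor, so the
  -- normalized bivector has zero derivative on the ball.
  have hconst : ∀ p ∈ Metric.ball u r, (fun p => (axis X v p i)⁻¹ • axis X v p) p =
      (fun p => (axis X v p i)⁻¹ • axis X v p) u := by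
    intro p hp
    have hd : ∀ q ∈ Metric.ball u r,
        HasFDerivAt (fun p => (axis X v p i)⁻¹ • axis X v p) (0 : Plane →L[ℝ] Bivector) q := by
      intro q hq
      have ha := (hdiff q (hball q hq).1).hasFDerivAt
      have hai := (hasDerivAt_inv (hball q hq).2).comp_hasFDerivAt q (hasFDerivAt_pi'.mp ha i)
      refine (hai.smul ha).congr_fderiv ?_
      ext1 y
      obtain ⟨θ, hθ⟩ := hder q (hball q hq).1 y
      have hne := (hball q hq).2
      simp only [add_apply, smul_apply,
        ContinuousLinearMap.smulRight_apply, ContinuousLinearMap.comp_apply,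
        ContinuousLinearMap.proj_apply, hθ, zero_apply, Pi.smul_apply,
        smul_eq_mul, smul_smul, ← add_smul]
      have h0 : ((fun y => y⁻¹) ∘ fun x => axis X v x i) q * θ +
          -(axis X v q i ^ 2)⁻¹ * (θ * axis X v q i) = 0 := by
        simp only [Function.comp_apply]
        field_simp
        ring
      rw [h0, zero_smul]
    exact (convex_ball u r).is_const_of_fderivWithin_eq_zero (𝕜 := ℝ)
      (fun q hq => (hd q hq).differentiableAt.differentiableWithinAt)
      (fun q hq => by
        rw [fderivWithin_of_isOpen Metric.isOpen_ball hq, (hd q hq).fderiv]) hp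
      (Metric.mem_ball_self hr)
  filter_upwards [Metric.ball_mem_nhds u hr] with p hp
  refine ⟨axis X v p i * (axis X v u i)⁻¹, mul_ne_zero (hball p hp).2 (inv_ne_zero hi), ?_⟩
  have hp' : (axis X v p i)⁻¹ • axis X v p = (axis X v u i)⁻¹ • axis X v u := hconst p hp
  rw [mul_smul, ← hp', smul_smul, mul_inv_cancel₀ (hball p hp).2, one_smul]

end IsPrincipalFrame

/-! ## The mean curvature vector of the normal geodesics -/

theorem Plane.eq_single_sum (y : Plane) :
    y = y 0 • EuclideanSpace.single 0 1 + y 1 • EuclideanSpace.single 1 1 := by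
  ext i
  fin_cases i <;> simp

/-- The trace of a symmetric bilinear form with respect to a metric in a null basis. -/
theorem trace_null_basis (g : Plane →ₗ[ℝ] Plane →ₗ[ℝ] ℝ) (q : Plane →ₗ[ℝ] Plane →ₗ[ℝ] ℝ)
    {v w : Plane} {m : ℝ} (hm : m ≠ 0) (hvv : g v v = 0) (hww : g w w = 0) (hvw : g v w = m)
    (hwv : g w v = m) (hspan : ∀ y, ∃ α β : ℝ, y = α • v + β • w) :
    ∑ i, ∑ j, (Matrix.of fun i j : Fin 2 =>
        g (EuclideanSpace.single i 1) (EuclideanSpace.single j 1))⁻¹ i j *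
          q (EuclideanSpace.single i 1) (EuclideanSpace.single j 1) = m⁻¹ * (q v w + q w v) := by
  -- In a null basis the inverse metric is `m⁻¹ (v ⊗ w + w ⊗ v)`; its coordinate matrix is checked
  -- against each basis vector expanded in `v, w`.
  have hinv : (Matrix.of fun i j : Fin 2 =>
        g (EuclideanSpace.single i 1) (EuclideanSpace.single j 1))⁻¹ =
      Matrix.of fun i j : Fin 2 => m⁻¹ * (v i * w j + w i * v j) := by
    apply Matrix.inv_eq_left_inv
    ext i k
    obtain ⟨α, β, hk⟩ := hspan (EuclideanSpace.single k 1)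
    have hv : v 0 * g (EuclideanSpace.single 0 1) (EuclideanSpace.single k 1) +
        v 1 * g (EuclideanSpace.single 1 1) (EuclideanSpace.single k 1) = β * m := by
      have : g v (EuclideanSpace.single k 1) = β * m := by rw [hk]; simp [hvv, hvw]
      rw [← this]
      conv_rhs => rw [Plane.eq_single_sum v]
      simp
    have hw : w 0 * g (EuclideanSpace.single 0 1) (EuclideanSpace.single k 1) +
        w 1 * g (EuclideanSpace.single 1 1) (EuclideanSpace.single k 1) = α * m := by
      have : g w (EuclideanSpace.single k 1) = α * m := by rw [hk]; simp [hww, hwv]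
      rw [← this]
      conv_rhs => rw [Plane.eq_single_sum w]
      simp
    have hki : (1 : Matrix (Fin 2) (Fin 2) ℝ) i k = α * v i + β * w i := by
      have := congrArg (fun y : Plane => y i) hk
      simpa [Matrix.one_apply] using this
    rw [hki, Matrix.mul_apply, Fin.sum_univ_two]
    simp only [Matrix.of_apply]
    calc _ = m⁻¹ * (v i * (w 0 * g (EuclideanSpace.single 0 1) (EuclideanSpace.single k 1) +
              w 1 * g (EuclideanSpace.single 1 1) (EuclideanSpace.single k 1)) +
            w i * (v 0 * g (EuclideanSpace.single 0 1) (EuclideanSpace.single k 1) +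
              v 1 * g (EuclideanSpace.single 1 1) (EuclideanSpace.single k 1))) := by ring
      _ = _ := by rw [hv, hw]; field_simp
  rw [hinv]
  conv_rhs => rw [Plane.eq_single_sum v, Plane.eq_single_sum w]
  simp [Fin.sum_univ_two]
  ring

namespace IsPrincipalFrame

variable {X N : Plane → Mink} {k l : Plane → ℝ} {v w : Plane → Plane} {U : Set Plane} {u : Plane}

theorem dirD_geodesics (h : IsPrincipalFrame X N k l v w U) (hu : u ∈ U) :
    dirD v (fun p => wedge (X p) (N p)) u =
      wedge (dirD v X u) (N u) - k u • wedge (X u) (dirD v X u) := by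
  rw [dirD_wedge (h.diffAt_X hu) (h.diffAt_N hu), h.shape_v u hu, wedge_neg_right,
    wedge_smul_right, sub_eq_add_neg]

/-- The only second derivative that enters the mean curvature, since the tangent vectors along `v`
and `w` are null. -/
theorem dirD_dirD_geodesics (h : IsPrincipalFrame X N k l v w U) (hu : u ∈ U) :
    dirD v (dirD w (fun p => wedge (X p) (N p))) u =
      geodCurv X v w u • wedge (dirD v X u) (N u) + (k u - l u) • wedge (dirD v X u) (dirD w X u)
        - dirD v l u • wedge (X u) (dirD w X u)
        - (l u * geodCurv X v w u) • wedge (X u) (dirD v X u) := by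
  have dX := h.diffAt_X hu
  have df := h.swap.diffAt_e hu
  have dl := h.swap.diffAt_k hu
  have dN := h.diffAt_N hu
  have d1 : DifferentiableAt ℝ (fun p => wedge (dirD w X p) (N p)) u :=
    (h.swap.smooth_e.wedge h.smooth_N).differentiableAt_of_isOpen h.isOpen hu
  have d2 : DifferentiableAt ℝ (fun p => wedge (X p) (dirD w X p)) u :=
    (h.smooth_X.wedge h.swap.smooth_e).differentiableAt_of_isOpen h.isOpen hu
  rw [dirD_congr h.isOpen (fun p hp => h.swap.dirD_geodesics hp) hu,
    dirD_sub d1 (dl.fun_smul d2), dirD_wedge df dN, dirD_smul dl d2, dirD_wedge dX df,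
    h.dirD_f_frame hu, h.shape_v u hu, wedge_smul_left, wedge_neg_right, wedge_smul_right,
    wedge_smul_right, wedge_swap (dirD w X u) (dirD v X u)]
  module

/-- If the normal geodesics are marginally trapped, then one of the principal curvatures is
stationary in the principal direction of the other one. -/
theorem dirD_mul_dirD_eq_zero (h : IsPrincipalFrame X N k l v w U) (hu : u ∈ U) {H : Bivector}
    (hH : IsMeanCurvatureVector (fun p => wedge (X p) (N p)) u H) (hnull : neutral H H = 0) :
    dirD v l u = 0 ∨ dirD w k u = 0 := by
  have hf := h.frame hu
  have hE := h.dirD_geodesics hu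
  have hE' := h.swap.dirD_geodesics hu
  have hD := h.dirD_dirD_geodesics hu
  have hcod := h.codazzi hu
  have hF : ContDiffOn ℝ ∞ (fun p => wedge (X p) (N p)) U := h.smooth_X.wedge h.smooth_N
  have hcomm := h.commutator hu hF
  have hneu := h.ne u hu
  have hV := hf.volume_ne_zero
  have hDD := dirD_dirD (v := v) hF h.smooth_w h.isOpen hu
  have hDD' := dirD_dirD (v := w) hF h.smooth_v h.isOpen hu
  have hdF := hF.fderiv_of_isOpen h.isOpen (m := ∞) (by simp)
  set F : Plane → Bivector := fun p => wedge (X p) (N p) with hFdef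
  set V := neutral (wedge (X u) (dirD v X u)) (wedge (dirD w X u) (N u)) with hVdef
  set e := dirD v X u
  set f := dirD w X u
  have p1 : neutral (wedge (X u) f) (wedge e (N u)) = -V := neutral_wedge_swap_mid _ _ _ _
  have p2 : neutral (wedge e (N u)) (wedge (X u) f) = -V := by rw [neutral_comm, p1]
  have p3 : neutral (wedge f (N u)) (wedge (X u) e) = V := by rw [neutral_comm]
  have p4 : neutral (wedge f (N u)) (wedge e f) = 0 := by
    rw [neutral_wedge_repeat₁₄]
  have p5 : ∀ a b, neutral (wedge a b) (wedge a b) = 0 := fun a b => neutral_wedge_repeat₁₃ _ _ _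
  -- The normal candidates are the tangent vectors with `k` and `l` exchanged. They are null, normal
  -- to the surface, and pair to `(k - l) V`.
  set ν₁ := wedge e (N u) - l u • wedge (X u) e with hν₁
  set ν₂ := wedge f (N u) - k u • wedge (X u) f with hν₂
  have tangent_iff : ∀ τ, (∀ i, neutral τ (partialD F u i) = 0) ↔
      neutral τ (dirD v F u) = 0 ∧ neutral τ (dirD w F u) = 0 := by
    intro τ
    have hlin : ∀ y : Plane, neutral τ (fderiv ℝ F u y) =
        y 0 * neutral τ (partialD F u 0) + y 1 * neutral τ (partialD F u 1) := by
      intro y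
      conv_lhs => rw [Plane.eq_single_sum y, map_add, map_smul, map_smul, neutral_add_right,
        neutral_smul_right, neutral_smul_right]
      rfl
    constructor
    · intro hτ
      simp [dirD, hlin, hτ]
    · rintro ⟨h1, h2⟩ i
      have := h.expand hu (EuclideanSpace.single i 1)
      rw [partialD, this, map_add, map_smul, map_smul, neutral_add_right, neutral_smul_right,
        neutral_smul_right]
      change _ * neutral τ (dirD v F u) + _ * neutral τ (dirD w F u) = 0
      rw [h1, h2]
      simp
  have hν₁n : IsNormalVector F u ν₁ := by
    refine ⟨⟨?_, ?_⟩, (tangent_iff _).mpr ⟨?_, ?_⟩⟩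
    · simp only [F, hν₁, neutral_sub_right, neutral_smul_right, neutral_wedge_repeat₂₄,
        neutral_wedge_repeat₁₃]
      ring
    · simp only [F, hν₁, bivInner_sub_right, bivInner_smul_right, bivInner_wedge, hf.xe, hf.xn,
        mink_comm (N u), hf.en]
      ring
    · rw [hE]
      simp only [hν₁, neutral_sub_right, neutral_smul_right, neutral_sub_left, neutral_smul_left,
        p5, neutral_wedge_repeat₁₄, neutral_wedge_repeat₂₃]
      ring
    · rw [hE']
      simp only [hν₁, neutral_sub_right, neutral_smul_right, neutral_sub_left, neutral_smul_left,
        p2, neutral_wedge_repeat₂₄, neutral_wedge_repeat₁₃, ← hVdef]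
      ring
  have hν₂n : IsNormalVector F u ν₂ := by
    refine ⟨⟨?_, ?_⟩, (tangent_iff _).mpr ⟨?_, ?_⟩⟩
    · simp only [F, hν₂, neutral_sub_right, neutral_smul_right, neutral_wedge_repeat₂₄,
        neutral_wedge_repeat₁₃]
      ring
    · simp only [F, hν₂, bivInner_sub_right, bivInner_smul_right, bivInner_wedge, hf.xf, hf.xn,
        mink_comm (N u), hf.fn]
      ring
    · rw [hE]
      simp only [hν₂, neutral_sub_right, neutral_smul_right, neutral_sub_left, neutral_smul_left,
        p1, p3, neutral_wedge_repeat₂₄, neutral_wedge_repeat₁₃]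
      ring
    · rw [hE']
      simp only [hν₂, neutral_sub_right, neutral_smul_right, neutral_sub_left, neutral_smul_left,
        p5, neutral_wedge_repeat₁₄, neutral_wedge_repeat₂₃]
      ring
  have q12 : neutral ν₁ ν₂ = (k u - l u) * V := by
    simp only [hν₁, hν₂, neutral_sub_right, neutral_smul_right, neutral_sub_left,
      neutral_smul_left, p2, neutral_wedge_repeat₂₄, neutral_wedge_repeat₁₃, ← hVdef]
    ring
  have q11 : neutral ν₁ ν₁ = 0 := by
    simp only [hν₁, neutral_sub_right, neutral_smul_right, neutral_sub_left, neutral_smul_left,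
      p5, neutral_wedge_repeat₁₄, neutral_wedge_repeat₂₃]
    ring
  have q22 : neutral ν₂ ν₂ = 0 := by
    simp only [hν₂, neutral_sub_right, neutral_smul_right, neutral_sub_left, neutral_smul_left,
      p5, neutral_wedge_repeat₁₄, neutral_wedge_repeat₂₃]
    ring
  have hkl : (k u - l u) * V ≠ 0 := mul_ne_zero (sub_ne_zero.mpr hneu) hV
  -- the mean curvature vector in the null basis of the normal plane
  obtain ⟨⟨hHt, hHn⟩, hHm⟩ := hH
  obtain ⟨hH1, hH2⟩ := (tangent_iff _).mp hHn
  obtain ⟨⟨n11, n12⟩, n13⟩ := id hν₁n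
  obtain ⟨⟨n21, n22⟩, n23⟩ := id hν₂n
  -- For a null basis the coefficient along one vector is read off by pairing with the other one.
  set α := neutral H ν₂ / ((k u - l u) * V) with hα
  set β := neutral H ν₁ / ((k u - l u) * V) with hβ
  -- The difference is tangent to the space of geodesics and orthogonal to both null normals and
  -- both tangent vectors. As `k ≠ l`, these four span the same space as `e ∧ N`, `f ∧ N`, `X ∧ e`,
  -- `X ∧ f`, so non-degeneracy forces it to vanish.
  have hτ : H - α • ν₁ - β • ν₂ = 0 := by
    have t1 : neutral (H - α • ν₁ - β • ν₂) ν₁ = 0 := by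
      rw [neutral_sub_left, neutral_sub_left, neutral_smul_left, neutral_smul_left, q11,
        neutral_comm ν₂, q12, hβ]
      field_simp
      ring
    have t2 : neutral (H - α • ν₁ - β • ν₂) ν₂ = 0 := by
      rw [neutral_sub_left, neutral_sub_left, neutral_smul_left, neutral_smul_left, q22, q12, hα]
      field_simp
      ring
    have t3 : neutral (H - α • ν₁ - β • ν₂) (dirD v F u) = 0 := by
      rw [neutral_sub_left, neutral_sub_left, neutral_smul_left, neutral_smul_left, hH1,
        ((tangent_iff _).mp n13).1, ((tangent_iff _).mp n23).1]
      ring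
    have t4 : neutral (H - α • ν₁ - β • ν₂) (dirD w F u) = 0 := by
      rw [neutral_sub_left, neutral_sub_left, neutral_smul_left, neutral_smul_left, hH2,
        ((tangent_iff _).mp n13).2, ((tangent_iff _).mp n23).2]
      ring
    have t5 : H - α • ν₁ - β • ν₂ ∈ geodesicTangent (F u) := by
      constructor
      · rw [neutral_sub_right, neutral_sub_right, neutral_smul_right, neutral_smul_right, hHt.1,
          n11, n21]
        ring
      · rw [bivInner_sub_right, bivInner_sub_right, bivInner_smul_right, bivInner_smul_right,
          hHt.2, n12, n22]
        ring
    have hlk : l u - k u ≠ 0 := sub_ne_zero.mpr hneu.symm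
    generalize H - α • ν₁ - β • ν₂ = τ at t1 t2 t3 t4 t5
    rw [hν₁, neutral_sub_right, neutral_smul_right] at t1
    rw [hν₂, neutral_sub_right, neutral_smul_right] at t2
    rw [hE, neutral_sub_right, neutral_smul_right] at t3
    rw [hE', neutral_sub_right, neutral_smul_right] at t4
    have s3 : neutral τ (wedge (X u) e) = 0 := by
      have : (l u - k u) * neutral τ (wedge (X u) e) = 0 := by linarith
      exact (mul_eq_zero.mp this).resolve_left hlk
    have s4 : neutral τ (wedge (X u) f) = 0 := by
      have : (l u - k u) * neutral τ (wedge (X u) f) = 0 := by linarith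
      exact (mul_eq_zero.mp this).resolve_left hlk
    exact hf.geodesicTangent_eq_zero t5 (by rw [s3] at t1; linarith)
      (by rw [s4] at t2; linarith) s3 s4
  -- The square of `α ν₁ + β ν₂` is `2 α β (k - l) V`, so nullity kills one coefficient.
  have hprod : neutral H ν₁ = 0 ∨ neutral H ν₂ = 0 := by
    have hHe : H = α • ν₁ + β • ν₂ := by rw [← sub_eq_zero, ← hτ]; abel
    rw [hHe, neutral_add_left, neutral_add_right, neutral_add_right] at hnull
    simp only [neutral_smul_left, neutral_smul_right, q11, q22, neutral_comm ν₂ ν₁, q12] at hnull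
    have : α * β * ((k u - l u) * V) = 0 := by linarith
    rcases mul_eq_zero.mp this with h0 | h0
    · rcases mul_eq_zero.mp h0 with h0 | h0
      · right; exact (div_eq_zero_iff.mp h0).resolve_right hkl
      · left; exact (div_eq_zero_iff.mp h0).resolve_right hkl
    · exact absurd h0 hkl
  -- the trace of the second fundamental form
  have hm : neutral (dirD v F u) (dirD w F u) = (l u - k u) * V := by
    rw [hE, hE']
    simp only [neutral_sub_right, neutral_smul_right, neutral_sub_left,
      neutral_smul_left, p2, neutral_wedge_repeat₂₄, neutral_wedge_repeat₁₃, ← hVdef]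
    ring
  have hlkV : (l u - k u) * V ≠ 0 := mul_ne_zero (sub_ne_zero.mpr hneu.symm) hV
  have trace : ∀ ν, IsNormalVector F u ν →
      neutral H ν = ((l u - k u) * V)⁻¹ * neutral (dirD v (dirD w F) u) ν := by
    intro ν hν
    obtain ⟨hνv, hνw⟩ := (tangent_iff _).mp hν.2
    have hνt : ∀ y, neutral (fderiv ℝ F u y) ν = 0 := by
      intro y
      rw [h.expand hu y, map_add, map_smul, map_smul, neutral_add_left, neutral_smul_left,
        neutral_smul_left]
      change _ * neutral (dirD v F u) ν + _ * neutral (dirD w F u) ν = 0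
      rw [neutral_comm _ ν, neutral_comm _ ν, hνv, hνw]
      simp
    rw [hHm ν hν]
    let g : Plane →ₗ[ℝ] Plane →ₗ[ℝ] ℝ := LinearMap.mk₂ ℝ
      (fun y z => neutral (fderiv ℝ F u y) (fderiv ℝ F u z))
      (fun _ _ _ => by rw [map_add, neutral_add_left])
      (fun _ _ _ => by rw [map_smul, neutral_smul_left, smul_eq_mul])
      (fun _ _ _ => by rw [map_add, neutral_add_right])
      (fun _ _ _ => by rw [map_smul, neutral_smul_right, smul_eq_mul])
    let q : Plane →ₗ[ℝ] Plane →ₗ[ℝ] ℝ := LinearMap.mk₂ ℝ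
      (fun y z => neutral (fderiv ℝ (fderiv ℝ F) u y z) ν)
      (fun _ _ _ => by rw [map_add, add_apply, neutral_add_left])
      (fun _ _ _ => by rw [map_smul, smul_apply, neutral_smul_left, smul_eq_mul])
      (fun _ _ _ => by rw [map_add, neutral_add_left])
      (fun _ _ _ => by rw [map_smul, neutral_smul_left, smul_eq_mul])
    have hsum : ∑ i, ∑ j, (inducedMetric F u)⁻¹ i j * neutral (partialD2 F u i j) ν =
        ∑ i, ∑ j, (Matrix.of fun i j : Fin 2 =>
          g (EuclideanSpace.single i 1) (EuclideanSpace.single j 1))⁻¹ i j *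
            q (EuclideanSpace.single i 1) (EuclideanSpace.single j 1) := by
      refine Finset.sum_congr rfl fun i _ => Finset.sum_congr rfl fun j _ => ?_
      congr 1
      simp only [q, LinearMap.mk₂_apply]
      congr 1
      have hd := hdF.differentiableAt_of_isOpen h.isOpen hu
      change fderiv ℝ (fun p => fderiv ℝ F p (EuclideanSpace.single j 1)) u _ = _
      rw [fderiv_clm_apply hd (differentiableAt_const _)]
      simp
    have gvv : g (v u) (v u) = 0 := by
      change neutral (dirD v F u) (dirD v F u) = 0
      rw [hE]
      simp only [neutral_sub_right, neutral_smul_right, neutral_sub_left, neutral_smul_left,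
        p5, neutral_wedge_repeat₁₄, neutral_wedge_repeat₂₃]
      ring
    have gww : g (w u) (w u) = 0 := by
      change neutral (dirD w F u) (dirD w F u) = 0
      rw [hE']
      simp only [neutral_sub_right, neutral_smul_right, neutral_sub_left, neutral_smul_left,
        p5, neutral_wedge_repeat₁₄, neutral_wedge_repeat₂₃]
      ring
    rw [hsum, trace_null_basis g q hlkV gvv gww hm (by rw [← hm]; exact neutral_comm _ _)
      (fun y => ⟨_, _, h.expand hu y⟩)]
    -- The Hessian of `F` and the iterated derivative along `v, w` differ by a tangent vector, which
    -- `ν` does not see.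
    have hq : q (v u) (w u) = neutral (dirD v (dirD w F) u) ν := by
      rw [hDD, neutral_add_left, hνt, add_zero]; rfl
    have hq' : q (w u) (v u) = neutral (dirD v (dirD w F) u) ν := by
      rw [← hq]
      simp only [q, LinearMap.mk₂_apply]
      rw [fderiv_fderiv_comm hF h.isOpen hu]
    rw [hq, hq']
    ring
  rcases hprod with h0 | h0
  · left
    rw [trace ν₁ hν₁n, hD] at h0
    simp only [hν₁, neutral_sub_right, neutral_smul_right, neutral_sub_left, neutral_smul_left,
      neutral_add_left, p1, p5, neutral_wedge_repeat₁₄, neutral_wedge_repeat₂₃,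
      neutral_wedge_repeat₁₃] at h0
    have h1 : ((l u - k u) * V)⁻¹ * V * dirD v l u = 0 := by linarith
    exact (mul_eq_zero.mp h1).resolve_left (mul_ne_zero (inv_ne_zero hlkV) hV)
  · right
    rw [trace ν₂ hν₂n, hD] at h0
    simp only [hν₂, neutral_sub_right, neutral_smul_right, neutral_sub_left, neutral_smul_left,
      neutral_add_left, p2, p5, neutral_wedge_repeat₂₃,
      neutral_wedge_repeat₁₃, neutral_wedge_repeat₂₄, ← hVdef] at h0
    -- The pairing with `ν₂` produces the geodesic curvature times `k - l`, which Codazzi identifies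
    -- with `-w(k)`.
    have h1 : ((l u - k u) * V)⁻¹ * V * dirD w k u = 0 := by
      rw [hcod]; linarith
    exact (mul_eq_zero.mp h1).resolve_left (mul_ne_zero (inv_ne_zero hlkV) hV)

end IsPrincipalFrame

/-! ## Principal curvatures of a surface patch -/

/-- A parametrized piece of a surface in hyperbolic space with unit normal field `N`. -/
structure IsSurfacePatch (X N : Plane → Mink) (U : Set Plane) : Prop where
  isOpen : IsOpen U
  smooth_X : ContDiffOn ℝ ∞ X U
  smooth_N : ContDiffOn ℝ ∞ N U
  xx : ∀ u ∈ U, mink (X u) (X u) = -1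
  nn : ∀ u ∈ U, mink (N u) (N u) = 1
  xn : ∀ u ∈ U, mink (X u) (N u) = 0
  injective : ∀ u ∈ U, Function.Injective (fderiv ℝ X u)
  normal : ∀ u ∈ U, ∀ y, mink (fderiv ℝ X u y) (N u) = 0

/-- The coefficients of the first fundamental form. -/
noncomputable def firstForm (X : Plane → Mink) (i j : Fin 2) (u : Plane) : ℝ :=
  mink (fderiv ℝ X u (EuclideanSpace.single i 1)) (fderiv ℝ X u (EuclideanSpace.single j 1))

/-- The coefficients of the second fundamental form. -/
noncomputable def secondForm (X N : Plane → Mink) (i j : Fin 2) (u : Plane) : ℝ :=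
  -mink (fderiv ℝ N u (EuclideanSpace.single i 1)) (fderiv ℝ X u (EuclideanSpace.single j 1))

/-- The coefficients of the pencil of the two fundamental forms. -/
noncomputable def pencil (X N : Plane → Mink) (κ : ℝ) (i j : Fin 2) (u : Plane) : ℝ :=
  secondForm X N i j u - κ * firstForm X i j u

/-- The characteristic polynomial of the pencil of the two fundamental forms. -/
noncomputable def charPencil (X N : Plane → Mink) (κ : ℝ) (u : Plane) : ℝ :=
  pencil X N κ 0 0 u * pencil X N κ 1 1 u - pencil X N κ 0 1 u ^ 2

/-- The leading coefficient of `charPencil`. -/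
noncomputable def quadA (X : Plane → Mink) (u : Plane) : ℝ :=
  firstForm X 0 0 u * firstForm X 1 1 u - firstForm X 0 1 u ^ 2

/-- The negative of the linear coefficient of `charPencil`. -/
noncomputable def quadB (X N : Plane → Mink) (u : Plane) : ℝ :=
  secondForm X N 0 0 u * firstForm X 1 1 u + secondForm X N 1 1 u * firstForm X 0 0 u -
    2 * (secondForm X N 0 1 u * firstForm X 0 1 u)

/-- The constant coefficient of `charPencil`. -/
noncomputable def quadC (X N : Plane → Mink) (u : Plane) : ℝ :=
  secondForm X N 0 0 u * secondForm X N 1 1 u - secondForm X N 0 1 u ^ 2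

/-- The discriminant of `charPencil`. -/
noncomputable def pencilDisc (X N : Plane → Mink) (u : Plane) : ℝ :=
  quadB X N u ^ 2 - 4 * (quadA X u * quadC X N u)

/-- The roots of `charPencil`. -/
noncomputable def pencilRoot (X N : Plane → Mink) (s : ℝ) (u : Plane) : ℝ :=
  (quadB X N u + s * √(pencilDisc X N u)) / (2 * quadA X u)

/-- The surface patch has the principal curvature `κ` at `u`. -/
def HasCurvature (X N : Plane → Mink) (u : Plane) (κ : ℝ) : Prop :=
  ∃ y : Plane, y ≠ 0 ∧ fderiv ℝ N u y = -(κ • fderiv ℝ X u y)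

namespace IsSurfacePatch

variable {X N : Plane → Mink} {U : Set Plane} {u : Plane}

theorem diffAt_X (h : IsSurfacePatch X N U) (hu : u ∈ U) : DifferentiableAt ℝ X u :=
  h.smooth_X.differentiableAt_of_isOpen h.isOpen hu

theorem diffAt_N (h : IsSurfacePatch X N U) (hu : u ∈ U) : DifferentiableAt ℝ N u :=
  h.smooth_N.differentiableAt_of_isOpen h.isOpen hu

theorem mink_X_fderiv_X (h : IsSurfacePatch X N U) (hu : u ∈ U) (y : Plane) :
    mink (X u) (fderiv ℝ X u y) = 0 :=
  mink_fderiv_eq_zero h.isOpen h.smooth_X h.xx hu y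

theorem mink_N_fderiv_N (h : IsSurfacePatch X N U) (hu : u ∈ U) (y : Plane) :
    mink (N u) (fderiv ℝ N u y) = 0 :=
  mink_fderiv_eq_zero h.isOpen h.smooth_N h.nn hu y

theorem mink_X_fderiv_N (h : IsSurfacePatch X N U) (hu : u ∈ U) (y : Plane) :
    mink (X u) (fderiv ℝ N u y) = 0 := by
  have h1 := dirD_eq_zero h.isOpen h.xn hu (fun _ => y)
  rw [dirD_mink (h.diffAt_X hu) (h.diffAt_N hu)] at h1
  change mink (fderiv ℝ X u y) (N u) + mink (X u) (fderiv ℝ N u y) = 0 at h1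
  rwa [h.normal u hu, zero_add] at h1

/-- Differentiating the orthogonality of `N` to the tangent vectors expresses the second fundamental
form through the Hessian of `X`, which is symmetric. -/
theorem second_symm (h : IsSurfacePatch X N U) (hu : u ∈ U) (y z : Plane) :
    mink (fderiv ℝ N u y) (fderiv ℝ X u z) = mink (fderiv ℝ N u z) (fderiv ℝ X u y) := by
  have key : ∀ y z : Plane, mink (fderiv ℝ (fderiv ℝ X) u y z) (N u) +
      mink (fderiv ℝ X u z) (fderiv ℝ N u y) = 0 := by
    intro y z
    have hd : ContDiffOn ℝ ∞ (dirD (fun _ => z) X) U :=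
      h.smooth_X.dirD contDiffOn_const h.isOpen
    have h1 := dirD_eq_zero h.isOpen (f := fun p => mink (dirD (fun _ => z) X p) (N p))
      (fun p hp => h.normal p hp z) hu (fun _ => y)
    rw [dirD_mink (hd.differentiableAt_of_isOpen h.isOpen hu) (h.diffAt_N hu),
      dirD_dirD h.smooth_X contDiffOn_const h.isOpen hu] at h1
    simpa [dirD] using h1
  have h1 := key y z
  have h2 := key z y
  rw [fderiv_fderiv_comm h.smooth_X h.isOpen hu] at h1
  rw [mink_comm _ (fderiv ℝ X u z), mink_comm _ (fderiv ℝ X u y)]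
  linarith

theorem first_pos (h : IsSurfacePatch X N U) (hu : u ∈ U) {y : Plane} (hy : y ≠ 0) :
    0 < mink (fderiv ℝ X u y) (fderiv ℝ X u y) :=
  mink_self_pos (h.xx u hu) (h.mink_X_fderiv_X hu y)
    (fun h0 => hy (h.injective u hu (by rw [h0, map_zero])))

theorem first_expand (X : Plane → Mink) (u : Plane) (y : Plane) :
    mink (fderiv ℝ X u y) (fderiv ℝ X u y) = y 0 ^ 2 * firstForm X 0 0 u +
      2 * (y 0 * y 1) * firstForm X 0 1 u + y 1 ^ 2 * firstForm X 1 1 u := by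
  conv_lhs => rw [Plane.eq_single_sum y]
  simp only [map_add, map_smul, mink_add_left, mink_add_right, mink_smul_left, mink_smul_right,
    firstForm]
  rw [mink_comm (fderiv ℝ X u (EuclideanSpace.single 1 1))]
  ring

theorem firstForm_pos (h : IsSurfacePatch X N U) (hu : u ∈ U) : 0 < firstForm X 0 0 u :=
  h.first_pos hu (by simp)

theorem quadA_pos (h : IsSurfacePatch X N U) (hu : u ∈ U) : 0 < quadA X u := by
  have h0 := h.firstForm_pos hu
  -- On the vector `(-F, E)` the first fundamental form takes the value `E (E G - F²)`.
  have hy : !₂[-firstForm X 0 1 u, firstForm X 0 0 u] ≠ 0 := by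
    intro hc
    have := congrArg (fun y : Plane => y 1) hc
    simp at this
    exact h0.ne' this
  have h1 := h.first_pos hu hy
  rw [first_expand] at h1
  simp at h1
  have h2 : 0 < firstForm X 0 0 u * quadA X u := by
    rw [quadA]; nlinarith
  exact (mul_pos_iff_of_pos_left h0).mp h2

theorem firstForm_symm (X : Plane → Mink) (u : Plane) : firstForm X 1 0 u = firstForm X 0 1 u :=
  mink_comm _ _

theorem secondForm_symm (h : IsSurfacePatch X N U) (hu : u ∈ U) :
    secondForm X N 1 0 u = secondForm X N 0 1 u := by
  rw [secondForm, secondForm, h.second_symm hu]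

theorem pencil_apply (X N : Plane → Mink) (u : Plane) (κ : ℝ) (y : Plane) (j : Fin 2) :
    mink (fderiv ℝ N u y + κ • fderiv ℝ X u y) (fderiv ℝ X u (EuclideanSpace.single j 1)) =
      -(y 0 * pencil X N κ 0 j u + y 1 * pencil X N κ 1 j u) := by
  conv_lhs => rw [Plane.eq_single_sum y]
  simp only [map_add, map_smul, mink_add_left, mink_smul_left, pencil, firstForm, secondForm]
  ring

/-- A vector in the kernel of the pencil is a principal vector. -/
theorem principal_iff (h : IsSurfacePatch X N U) (hu : u ∈ U) (κ : ℝ) (y : Plane) :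
    fderiv ℝ N u y = -(κ • fderiv ℝ X u y) ↔
      y 0 * pencil X N κ 0 0 u + y 1 * pencil X N κ 0 1 u = 0 ∧
        y 0 * pencil X N κ 0 1 u + y 1 * pencil X N κ 1 1 u = 0 := by
  have hs : pencil X N κ 1 0 u = pencil X N κ 0 1 u := by
    rw [pencil, pencil, firstForm_symm, h.secondForm_symm hu]
  have h0 := pencil_apply X N u κ y 0
  have h1 := pencil_apply X N u κ y 1
  rw [hs] at h0
  rw [← add_eq_zero_iff_eq_neg]
  constructor
  · intro hz
    rw [hz, mink_zero_left] at h0 h1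
    constructor <;> linarith
  · rintro ⟨hz0, hz1⟩
    rw [hz0, neg_zero] at h0
    rw [hz1, neg_zero] at h1
    -- The residual `dN(y) + κ dX(y)` is automatically orthogonal to `X` and `N`, so only its
    -- products with the two coordinate tangent vectors matter.
    refine eq_zero_of_orthogonal (h.xx u hu) (h.nn u hu) (h.xn u hu) (h.mink_X_fderiv_X hu _)
      (h.mink_X_fderiv_X hu _) (h.normal u hu _) (h.normal u hu _) ?_ ?_ ?_ h0 h1
    · intro α β hαβ
      rw [← map_smul, ← map_smul, ← map_add] at hαβ
      have := h.injective u hu (hαβ.trans (map_zero _).symm)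
      exact ⟨by simpa using congrArg (fun y : Plane => y 0) this,
        by simpa using congrArg (fun y : Plane => y 1) this⟩
    · rw [mink_add_left, mink_smul_left, mink_comm _ (X u), mink_comm _ (X u),
        h.mink_X_fderiv_N hu, h.mink_X_fderiv_X hu]
      ring
    · rw [mink_add_left, mink_smul_left, h.normal u hu, mink_comm, h.mink_N_fderiv_N hu]
      ring

theorem hasCurvature_iff (h : IsSurfacePatch X N U) (hu : u ∈ U) (κ : ℝ) :
    HasCurvature X N u κ ↔ charPencil X N κ u = 0 := by
  constructor
  · rintro ⟨y, hy, hyκ⟩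
    obtain ⟨h0, h1⟩ := (h.principal_iff hu κ y).mp hyκ
    have e0 : y 0 * charPencil X N κ u = 0 := by
      rw [charPencil]
      linear_combination pencil X N κ 1 1 u * h0 - pencil X N κ 0 1 u * h1
    have e1 : y 1 * charPencil X N κ u = 0 := by
      rw [charPencil]
      linear_combination pencil X N κ 0 0 u * h1 - pencil X N κ 0 1 u * h0
    by_contra hne
    apply hy
    ext i
    fin_cases i
    · exact (mul_eq_zero.mp e0).resolve_right hne
    · exact (mul_eq_zero.mp e1).resolve_right hne
  · intro hc
    rw [charPencil] at hc
    -- A singular symmetric `2 × 2` matrix kills the vector orthogonal to its first row; if that row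
    -- vanishes, it kills the first basis vector.
    by_cases h1 : pencil X N κ 0 1 u = 0 ∧ pencil X N κ 0 0 u = 0
    · refine ⟨EuclideanSpace.single 0 1, by simp, (h.principal_iff hu κ _).mpr ?_⟩
      simp [h1]
    · refine ⟨!₂[pencil X N κ 0 1 u, -pencil X N κ 0 0 u], fun hz => h1 ?_,
        (h.principal_iff hu κ _).mpr ?_⟩
      · exact ⟨by simpa using congrArg (fun y : Plane => y 0) hz,
          by simpa using congrArg (fun y : Plane => y 1) hz⟩
      · simp only [Matrix.cons_val_zero, Matrix.cons_val_one]
        constructor <;> linarith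

theorem charPencil_eq (X N : Plane → Mink) (κ : ℝ) (u : Plane) :
    charPencil X N κ u = quadA X u * κ ^ 2 - quadB X N u * κ + quadC X N u := by
  rw [charPencil, pencil, pencil, pencil, quadA, quadB, quadC]
  ring

theorem smooth_firstForm (h : IsSurfacePatch X N U) (i j : Fin 2) :
    ContDiffOn ℝ ∞ (firstForm X i j) U :=
  (h.smooth_X.dirD contDiffOn_const h.isOpen).mink (h.smooth_X.dirD contDiffOn_const h.isOpen)

theorem smooth_secondForm (h : IsSurfacePatch X N U) (i j : Fin 2) :
    ContDiffOn ℝ ∞ (secondForm X N i j) U :=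
  ((h.smooth_N.dirD contDiffOn_const h.isOpen).mink
    (h.smooth_X.dirD contDiffOn_const h.isOpen)).neg

theorem smooth_quadA (h : IsSurfacePatch X N U) : ContDiffOn ℝ ∞ (quadA X) U :=
  ((h.smooth_firstForm 0 0).mul (h.smooth_firstForm 1 1)).sub ((h.smooth_firstForm 0 1).pow 2)

theorem smooth_quadB (h : IsSurfacePatch X N U) : ContDiffOn ℝ ∞ (quadB X N) U :=
  (((h.smooth_secondForm 0 0).mul (h.smooth_firstForm 1 1)).add
    ((h.smooth_secondForm 1 1).mul (h.smooth_firstForm 0 0))).sub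
      (contDiffOn_const.mul ((h.smooth_secondForm 0 1).mul (h.smooth_firstForm 0 1)))

theorem smooth_quadC (h : IsSurfacePatch X N U) : ContDiffOn ℝ ∞ (quadC X N) U :=
  ((h.smooth_secondForm 0 0).mul (h.smooth_secondForm 1 1)).sub ((h.smooth_secondForm 0 1).pow 2)

theorem smooth_pencilRoot (h : IsSurfacePatch X N U) (hd : ∀ u ∈ U, 0 < pencilDisc X N u)
    (s : ℝ) : ContDiffOn ℝ ∞ (pencilRoot X N s) U := by
  have h1 : ContDiffOn ℝ ∞ (pencilDisc X N) U :=
    (h.smooth_quadB.pow 2).sub (contDiffOn_const.mul (h.smooth_quadA.mul h.smooth_quadC))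
  have h2 : ContDiffOn ℝ ∞ (fun u => √(pencilDisc X N u)) U := h1.sqrt fun u hu => (hd u hu).ne'
  exact (h.smooth_quadB.add (contDiffOn_const.mul h2)).div
    (contDiffOn_const.mul h.smooth_quadA)
    fun u hu => mul_ne_zero two_ne_zero (h.quadA_pos hu).ne'

theorem charPencil_factor (h : IsSurfacePatch X N U) (hu : u ∈ U) (hd : 0 < pencilDisc X N u)
    (κ : ℝ) : charPencil X N κ u =
      quadA X u * ((κ - pencilRoot X N (-1) u) * (κ - pencilRoot X N 1 u)) := by
  have ha := (h.quadA_pos hu).ne'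
  have hs := Real.sq_sqrt hd.le
  rw [charPencil_eq, pencilRoot, pencilRoot]
  set r := √(pencilDisc X N u)
  rw [pencilDisc] at hs
  field_simp
  linear_combination hs

theorem pencilRoot_lt (h : IsSurfacePatch X N U) (hu : u ∈ U) (hd : 0 < pencilDisc X N u) :
    pencilRoot X N (-1) u < pencilRoot X N 1 u := by
  have ha := h.quadA_pos hu
  have hs := Real.sqrt_pos.mpr hd
  rw [pencilRoot, pencilRoot]
  apply div_lt_div_of_pos_right _ (by linarith)
  linarith

theorem setOf_hasCurvature (h : IsSurfacePatch X N U) (hu : u ∈ U)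
    (hd : 0 < pencilDisc X N u) :
    {κ | HasCurvature X N u κ} = {pencilRoot X N (-1) u, pencilRoot X N 1 u} := by
  ext κ
  rw [mem_ofPred_eq, h.hasCurvature_iff hu, h.charPencil_factor hu hd, mul_eq_zero, mul_eq_zero,
    sub_eq_zero, sub_eq_zero]
  simp [(h.quadA_pos hu).ne']

/-- If all directions are principal, then the metric induced on the normal geodesics vanishes. -/
theorem inducedMetric_eq_zero (h : IsSurfacePatch X N U) (hu : u ∈ U) {κ : ℝ}
    (hκ : ∀ y, fderiv ℝ N u y = -(κ • fderiv ℝ X u y)) :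
    inducedMetric (fun p => wedge (X p) (N p)) u = 0 := by
  have hF : ∀ i, partialD (fun p => wedge (X p) (N p)) u i =
      wedge (fderiv ℝ X u (EuclideanSpace.single i 1)) (N u) -
        κ • wedge (X u) (fderiv ℝ X u (EuclideanSpace.single i 1)) := by
    intro i
    have := dirD_wedge (h.diffAt_X hu) (h.diffAt_N hu) (fun _ => EuclideanSpace.single i 1)
    rw [dirD, dirD, dirD, hκ, wedge_neg_right, wedge_smul_right] at this
    rw [partialD, this, sub_eq_add_neg]
  ext i j
  simp only [inducedMetric, Matrix.of_apply, hF, neutral_sub_left, neutral_sub_right,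
    neutral_smul_left, neutral_smul_right, neutral_wedge_repeat₂₄, neutral_wedge_repeat₁₃,
    Matrix.zero_apply]
  have h1 := neutral_wedge_swap_mid (X u) (fderiv ℝ X u (EuclideanSpace.single i 1))
    (fderiv ℝ X u (EuclideanSpace.single j 1)) (N u)
  rw [neutral_comm] at h1
  rw [h1]
  ring

/-- The discriminant is positive where the normal geodesics have a non-degenerate metric. -/
theorem pencilDisc_pos (h : IsSurfacePatch X N U) (hu : u ∈ U)
    (hdet : (inducedMetric (fun p => wedge (X p) (N p)) u).det ≠ 0) : 0 < pencilDisc X N u := by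
  have h0 := h.firstForm_pos hu
  have hA := h.quadA_pos hu
  set E := firstForm X 0 0 u with hE
  set F := firstForm X 0 1 u with hF
  set G := firstForm X 1 1 u with hG
  set L := secondForm X N 0 0 u with hL
  set M := secondForm X N 0 1 u with hM
  set P := secondForm X N 1 1 u with hP
  have hAe : quadA X u = E * G - F ^ 2 := rfl
  -- Up to the positive factor `E²` the discriminant is a sum of two squares with positive weights.
  -- If it is not positive, both squares vanish and the second form is proportional to the first: an
  -- umbilic, where the induced metric would be zero.
  have hid : E ^ 2 * pencilDisc X N u =
      (E * (E * P - G * L) - 2 * F * (E * M - F * L)) ^ 2 +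
        4 * quadA X u * (E * M - F * L) ^ 2 := by
    rw [pencilDisc, hAe]
    change E ^ 2 * ((L * G + P * E - 2 * (M * F)) ^ 2 - 4 * ((E * G - F ^ 2) * (L * P - M ^ 2))) = _
    ring
  by_contra hcon
  have hle : E ^ 2 * pencilDisc X N u ≤ 0 :=
    mul_nonpos_of_nonneg_of_nonpos (sq_nonneg _) (not_lt.mp hcon)
  have hQ : E * M - F * L = 0 := by
    have : quadA X u * (E * M - F * L) ^ 2 ≤ 0 := by
      nlinarith [sq_nonneg (E * (E * P - G * L) - 2 * F * (E * M - F * L))]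
    have h2 : (E * M - F * L) ^ 2 ≤ 0 := by
      by_contra hc
      exact absurd (mul_pos hA (not_le.mp hc)) (not_lt.mpr this)
    exact pow_eq_zero_iff two_ne_zero |>.mp (le_antisymm h2 (sq_nonneg _))
  have hR : E * P - G * L = 0 := by
    rw [hQ] at hid
    have h2 : (E * (E * P - G * L)) ^ 2 = 0 := by
      apply le_antisymm _ (sq_nonneg _)
      nlinarith
    exact (mul_eq_zero.mp (pow_eq_zero_iff two_ne_zero |>.mp h2)).resolve_left h0.ne'
  apply hdet
  suffices hy : ∀ y, fderiv ℝ N u y = -((L / E) • fderiv ℝ X u y) by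
    rw [h.inducedMetric_eq_zero hu hy, Matrix.det_zero]
  intro y
  rw [h.principal_iff hu]
  have e0 : pencil X N (L / E) 0 0 u = 0 := by
    change L - L / E * E = 0
    field_simp; ring
  have e1 : pencil X N (L / E) 0 1 u = 0 := by
    change M - L / E * F = 0
    field_simp; linarith
  have e2 : pencil X N (L / E) 1 1 u = 0 := by
    change P - L / E * G = 0
    field_simp; linarith
  rw [e0, e1, e2]
  simp

/-- Local existence of smooth unit principal vector fields. -/
theorem exists_principal_field (h : IsSurfacePatch X N U) {κ : Plane → ℝ}
    (hκ : ContDiffOn ℝ ∞ κ U) (hroot : ∀ u ∈ U, charPencil X N (κ u) u = 0)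
    (hdisc : ∀ u ∈ U, 0 < pencilDisc X N u) (hu : u ∈ U) :
    ∃ U' ⊆ U, IsOpen U' ∧ u ∈ U' ∧ ∃ v : Plane → Plane, ContDiffOn ℝ ∞ v U' ∧
      (∀ p ∈ U', mink (dirD v X p) (dirD v X p) = 1) ∧
      ∀ p ∈ U', dirD v N p = -(κ p • dirD v X p) := by
  have hpen : ∀ i j, ContDiffOn ℝ ∞ (fun p => pencil X N (κ p) i j p) U := fun i j =>
    (h.smooth_secondForm i j).sub (hκ.mul (h.smooth_firstForm i j))
  -- it suffices to find a principal vector field without zero at the given point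
  suffices hy : ∃ y : Plane → Plane, ContDiffOn ℝ ∞ y U ∧ y u ≠ 0 ∧
      ∀ p ∈ U, fderiv ℝ N p (y p) = -(κ p • fderiv ℝ X p (y p)) by
    obtain ⟨y, hys, hyu, hyκ⟩ := hy
    refine ⟨U ∩ y ⁻¹' {0}ᶜ, inter_subset_left,
      hys.continuousOn.isOpen_inter_preimage h.isOpen isOpen_compl_singleton, ⟨hu, hyu⟩, ?_⟩
    have hpos : ∀ p ∈ U ∩ y ⁻¹' {0}ᶜ, 0 < mink (dirD y X p) (dirD y X p) := fun p hp =>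
      h.first_pos hp.1 hp.2
    have hsm : ContDiffOn ℝ ∞ (fun p => (√(mink (dirD y X p) (dirD y X p)))⁻¹)
        (U ∩ y ⁻¹' {0}ᶜ) := by
      have hm : ContDiffOn ℝ ∞ (fun p => mink (dirD y X p) (dirD y X p)) (U ∩ y ⁻¹' {0}ᶜ) :=
        ((h.smooth_X.dirD hys h.isOpen).mink (h.smooth_X.dirD hys h.isOpen)).mono
          inter_subset_left
      exact (hm.sqrt fun p hp => (hpos p hp).ne').inv fun p hp =>
        (Real.sqrt_pos.mpr (hpos p hp)).ne'
    refine ⟨fun p => (√(mink (dirD y X p) (dirD y X p)))⁻¹ • y p,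
      hsm.smul (hys.mono inter_subset_left), fun p hp => ?_, fun p hp => ?_⟩
    · have hs := Real.sqrt_pos.mpr (hpos p hp)
      have hsq := Real.sq_sqrt (hpos p hp).le
      change mink (fderiv ℝ X p (_ • y p)) (fderiv ℝ X p (_ • y p)) = 1
      rw [map_smul, mink_smul_left, mink_smul_right]
      change _ * (_ * mink (dirD y X p) (dirD y X p)) = 1
      set s := √(mink (dirD y X p) (dirD y X p))
      rw [← hsq]
      field_simp
    · change fderiv ℝ N p (_ • y p) = -(κ p • fderiv ℝ X p (_ • y p))
      rw [map_smul, map_smul, hyκ p hp.1, smul_neg, smul_comm]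
  have hsmooth : ∀ a b : Plane → ℝ, ContDiffOn ℝ ∞ a U → ContDiffOn ℝ ∞ b U →
      ContDiffOn ℝ ∞ (fun p => (!₂[a p, b p] : Plane)) U := by
    intro a b ha hb
    rw [contDiffOn_euclidean]
    intro i
    fin_cases i
    · exact ha
    · exact hb
  -- Each row of the singular pencil provides a smooth kernel field. Both fields vanish at `u` only
  -- if the whole pencil does, that is, at an umbilic, which the positive discriminant excludes.
  by_cases h1 : pencil X N (κ u) 0 1 u = 0 ∧ pencil X N (κ u) 0 0 u = 0
  · refine ⟨fun p => !₂[pencil X N (κ p) 1 1 p, -pencil X N (κ p) 0 1 p],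
      hsmooth _ _ (hpen 1 1) (hpen 0 1).neg, fun hz => ?_, fun p hp => ?_⟩
    · have h2 : pencil X N (κ u) 1 1 u = 0 := by
        simpa using congrArg (fun y : Plane => y 0) hz
      have hd := hdisc u hu
      have e0 : secondForm X N 0 0 u = κ u * firstForm X 0 0 u := by
        have := h1.2; rw [pencil] at this; linarith
      have e1 : secondForm X N 0 1 u = κ u * firstForm X 0 1 u := by
        have := h1.1; rw [pencil] at this; linarith
      have e2 : secondForm X N 1 1 u = κ u * firstForm X 1 1 u := by
        rw [pencil] at h2; linarith
      have : pencilDisc X N u = 0 := by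
        rw [pencilDisc, quadA, quadB, quadC, e0, e1, e2]; ring
      exact hd.ne' this
    · rw [h.principal_iff hp]
      have := hroot p hp
      rw [charPencil] at this
      simp only [Matrix.cons_val_zero, Matrix.cons_val_one]
      constructor <;> linarith
  · refine ⟨fun p => !₂[pencil X N (κ p) 0 1 p, -pencil X N (κ p) 0 0 p],
      hsmooth _ _ (hpen 0 1) (hpen 0 0).neg, fun hz => h1 ?_, fun p hp => ?_⟩
    · exact ⟨by simpa using congrArg (fun y : Plane => y 0) hz,
          by simpa using congrArg (fun y : Plane => y 1) hz⟩
    · rw [h.principal_iff hp]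
      have := hroot p hp
      rw [charPencil] at this
      simp only [Matrix.cons_val_zero, Matrix.cons_val_one]
      constructor <;> linarith

/-- Local existence of principal frames. -/
theorem exists_principalFrame (h : IsSurfacePatch X N U)
    (hdisc : ∀ u ∈ U, 0 < pencilDisc X N u) (hu : u ∈ U) :
    ∃ U' ⊆ U, u ∈ U' ∧ ∃ v w : Plane → Plane,
      IsPrincipalFrame X N (pencilRoot X N (-1)) (pencilRoot X N 1) v w U' := by
  obtain ⟨U₁, hU₁, ho₁, hu₁, v, hv, hve, hvs⟩ := h.exists_principal_field
    (h.smooth_pencilRoot hdisc (-1))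
    (fun p hp => by rw [h.charPencil_factor hp (hdisc p hp)]; ring) hdisc hu
  obtain ⟨U₂, hU₂, ho₂, hu₂, w, hw, hwe, hws⟩ := h.exists_principal_field
    (h.smooth_pencilRoot hdisc 1)
    (fun p hp => by rw [h.charPencil_factor hp (hdisc p hp)]; ring) hdisc hu
  have hs : U₁ ∩ U₂ ⊆ U := inter_subset_left.trans hU₁
  refine ⟨U₁ ∩ U₂, hs, ⟨hu₁, hu₂⟩, v, w, ?_⟩
  exact
    { isOpen := ho₁.inter ho₂
      smooth_X := h.smooth_X.mono hs
      smooth_N := h.smooth_N.mono hs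
      smooth_k := (h.smooth_pencilRoot hdisc (-1)).mono hs
      smooth_l := (h.smooth_pencilRoot hdisc 1).mono hs
      smooth_v := hv.mono inter_subset_left
      smooth_w := hw.mono inter_subset_right
      xx := fun p hp => h.xx p (hs hp)
      nn := fun p hp => h.nn p (hs hp)
      xn := fun p hp => h.xn p (hs hp)
      injective := fun p hp => h.injective p (hs hp)
      normal := fun p hp => h.normal p (hs hp)
      ee := fun p hp => hve p hp.1
      ff := fun p hp => hwe p hp.2
      ef := fun p hp => by
        -- The shape operator is self-adjoint, so eigenvectors for distinct eigenvalues are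
        -- orthogonal.
        have h1 := h.second_symm (hs hp) (v p) (w p)
        change mink (dirD v N p) (dirD w X p) = mink (dirD w N p) (dirD v X p) at h1
        rw [hvs p hp.1, hws p hp.2, mink_neg_left, mink_neg_left, mink_smul_left, mink_smul_left,
          mink_comm (dirD w X p)] at h1
        have h2 := h.pencilRoot_lt (hs hp) (hdisc p (hs hp))
        have h3 : (pencilRoot X N 1 p - pencilRoot X N (-1) p) *
          mink (dirD v X p) (dirD w X p) = 0 := by linarith
        exact (mul_eq_zero.mp h3).resolve_left (sub_pos.mpr h2).ne'
      shape_v := fun p hp => hvs p hp.1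
      shape_w := fun p hp => hws p hp.2
      ne := fun p hp => (h.pencilRoot_lt (hs hp) (hdisc p (hs hp))).ne }

end IsSurfacePatch

/-! ## One-parameter groups of rotations -/

theorem exp_smul_add (L : Mink →L[ℝ] Mink) (s t : ℝ) :
    NormedSpace.exp ((s + t) • L) = NormedSpace.exp (s • L) * NormedSpace.exp (t • L) := by
  let _ : NormedAlgebra ℚ (Mink →L[ℝ] Mink) := NormedAlgebra.restrictScalars ℚ ℝ _
  rw [add_smul]
  exact NormedSpace.exp_add_of_commute (((Commute.refl L).smul_left s).smul_right t)

theorem exp_smul_cancel (L : Mink →L[ℝ] Mink) (t : ℝ) (y : Mink) :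
    NormedSpace.exp (t • L) (NormedSpace.exp (-t • L) y) = y := by
  have h := exp_smul_add L t (-t)
  rw [add_neg_cancel, zero_smul, NormedSpace.exp_zero] at h
  exact (DFunLike.congr_fun h y).symm

theorem hasDerivAt_exp_smul_apply (L : Mink →L[ℝ] Mink) (y : Mink) (t : ℝ) :
    HasDerivAt (fun s : ℝ => NormedSpace.exp (s • L) y) (L (NormedSpace.exp (t • L) y)) t := by
  have h := (hasDerivAt_exp_smul_const' L t).clm_apply (hasDerivAt_const t y)
  simpa using h

/-- Solutions of a linear differential equation are given by the exponential map. -/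
theorem eq_exp_smul_apply {L : Mink →L[ℝ] Mink} {γ : ℝ → Mink} {ε : ℝ}
    (hγ : ∀ t ∈ Ioo (-ε) ε, HasDerivAt γ (L (γ t)) t) {t : ℝ} (ht : t ∈ Ioo (-ε) ε) :
    γ t = NormedSpace.exp (t • L) (γ 0) := by
  have hε : (0 : ℝ) ∈ Ioo (-ε) ε := ⟨by linarith [ht.1, ht.2], by linarith [ht.1, ht.2]⟩
  -- Transporting the solution back by the inverse flow gives a curve with zero derivative.
  have hd : ∀ s ∈ Ioo (-ε) ε,
      HasDerivAt (fun s => NormedSpace.exp (-s • L) (γ s)) 0 s := by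
    intro s hs
    have h1 := ((hasDerivAt_exp_smul_const L (-s)).scomp s (hasDerivAt_neg s)).clm_apply (hγ s hs)
    refine h1.congr_deriv ?_
    simp
  have hconst := isOpen_Ioo.is_const_of_deriv_eq_zero (𝕜 := ℝ) isPreconnected_Ioo
    (fun s hs => (hd s hs).differentiableAt.differentiableWithinAt)
    (fun s hs => (hd s hs).deriv) ht hε
  have hconst' : NormedSpace.exp (-t • L) (γ t) = γ 0 := by simpa using hconst
  rw [← hconst', exp_smul_cancel]

/-- The one-parameter group generated by a decomposable bivector. -/
theorem isRotationGroup_exp {a b y z : Mink} (hya : mink y a ≠ 0) (hyb : mink y b = 0)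
    (hza : mink z a = 0) (hzb : mink z b ≠ 0) :
    IsRotationGroup fun t => NormedSpace.exp (t • contractL (wedge a b)) where
  zero := by simp [NormedSpace.exp_zero]; rfl
  add := exp_smul_add _
  continuous := continuous_iff_continuousAt.mpr fun t =>
    (hasDerivAt_exp_smul_const (contractL (wedge a b)) t).continuousAt
  isometry := by
    intro t v w
    set L := contractL (wedge a b)
    have hd : ∀ s : ℝ, HasDerivAt
        (fun s : ℝ => mink (NormedSpace.exp (s • L) v) (NormedSpace.exp (s • L) w)) 0 s := by
      intro s
      have h1 := (hasDerivAt_exp_smul_apply L v s)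
      have h2 := (hasDerivAt_exp_smul_apply L w s)
      have h3 := (minkB.hasFDerivAt.comp_hasDerivAt s h1).clm_apply h2
      refine h3.congr_deriv (Eq.symm ?_)
      change 0 = mink (contract (wedge a b) _) _ + mink _ (contract (wedge a b) _)
      rw [mink_contract]
      ring
    have := is_const_of_deriv_eq_zero (fun s => (hd s).differentiableAt)
      (fun s => (hd s).deriv) t 0
    simpa [NormedSpace.exp_zero] using this
  nontrivial := by
    by_contra! hcon
    -- If all members of the group were the identity, the generator would kill `y`; pairing its
    -- value at `y` with `z` contradicts `hya` and `hzb`.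
    have h1 := hasDerivAt_exp_smul_apply (contractL (wedge a b)) y 0
    simp only [hcon] at h1
    have h2 := h1.unique (hasDerivAt_const (0 : ℝ) y)
    have h3 : mink y a • b - mink y b • a = 0 := by
      rw [← contract_wedge]; exact h2
    rw [hyb, zero_smul, sub_zero] at h3
    have h4 := congrArg (mink z) h3
    rw [mink_smul_right, mink_zero_right] at h4
    exact mul_ne_zero hya hzb h4
  fixed := by
    -- The fixed subspace is the orthogonal complement of `a` and `b`. The vectors `y` and `z`, dual
    -- to them up to scale, show that it has codimension two even if the plane of `a, b` is
    -- degenerate.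
    let T : Mink →ₗ[ℝ] ℝ × ℝ :=
      (((minkB a : Mink →L[ℝ] ℝ) : Mink →ₗ[ℝ] ℝ).prod ((minkB b : Mink →L[ℝ] ℝ) : Mink →ₗ[ℝ] ℝ))
    have hT : ∀ p, T p = (mink a p, mink b p) := fun p => rfl
    refine ⟨LinearMap.ker T, ?_, ?_⟩
    · have hsurj : Function.Surjective T := by
        rintro ⟨r, s⟩
        refine ⟨(r / mink y a) • y + (s / mink z b) • z, ?_⟩
        rw [hT]
        rw [mink_comm a, mink_comm b]
        simp only [mink_add_left, mink_smul_left, hyb, hza]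
        ext <;> simp <;> field_simp
      have h1 := LinearMap.finrank_range_add_finrank_ker T
      rw [LinearMap.range_eq_top.mpr hsurj, finrank_top] at h1
      simp at h1
      omega
    · intro t v hv
      have hv' : (mink a v, mink b v) = (0, 0) := hv
      rw [Prod.mk.injEq, mink_comm, mink_comm b] at hv'
      have hLv : contractL (wedge a b) v = 0 := by
        rw [contractL_apply, contract_wedge, hv'.1, hv'.2, zero_smul, zero_smul, sub_zero]
      have := eq_exp_smul_apply (L := contractL (wedge a b)) (γ := fun _ => v) (ε := |t| + 1)
        (fun s _ => by rw [hLv]; exact hasDerivAt_const s v) (t := t)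
        ⟨by linarith [neg_abs_le t], by linarith [le_abs_self t]⟩
      exact this.symm

/-! ## Surfaces in charts -/

theorem eventually_of_chart {M : Type*} [TopologicalSpace M] {e : OpenPartialHomeomorph M Plane}
    {u : Plane} (hu : u ∈ e.target) {P : M → Prop} (hP : ∀ᶠ z in 𝓝 u, P (e.symm z)) :
    ∀ᶠ r in 𝓝 (e.symm u), P r := by
  have hs := e.map_target hu
  have ht : Filter.Tendsto e (𝓝 (e.symm u)) (𝓝 u) := by
    have := e.continuousAt hs
    rwa [ContinuousAt, e.right_inv hu] at this
  filter_upwards [ht.eventually hP, e.open_source.mem_nhds hs] with r hr hrs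
  rwa [e.left_inv hrs] at hr

section Charts

variable {M : Type*} [TopologicalSpace M] [ChartedSpace Plane M]

theorem contDiffOn_comp_symm {E : Type*} [NormedAddCommGroup E] [NormedSpace ℝ E] {n : ℕ∞ω}
    [IsManifold (𝓡 2) n M] {f : M → E} (hf : ContMDiff (𝓡 2) 𝓘(ℝ, E) n f)
    {e : OpenPartialHomeomorph M Plane} (he : e ∈ atlas Plane M) :
    ContDiffOn ℝ n (f ∘ e.symm) e.target := by
  rw [← contMDiffOn_iff_contDiffOn]
  exact hf.comp_contMDiffOn
    (contMDiffOn_symm_of_mem_maximalAtlas (IsManifold.subset_maximalAtlas he))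

/-- The differential of a chart. -/
noncomputable def chartD (e : OpenPartialHomeomorph M Plane) (q : M) (y : TangentSpace (𝓡 2) q) :
    Plane :=
  mfderiv (𝓡 2) (𝓡 2) e q y

theorem chartD_zero (e : OpenPartialHomeomorph M Plane) (q : M) :
    chartD e q (0 : TangentSpace (𝓡 2) q) = 0 :=
  map_zero (mfderiv (𝓡 2) (𝓡 2) e q)

variable [IsManifold (𝓡 2) ∞ M]

theorem mdifferentiable_of_smooth {e : OpenPartialHomeomorph M Plane} (he : e ∈ atlas Plane M) :
    e.MDifferentiable (𝓡 2) (𝓡 2) :=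
  have : IsManifold (𝓡 2) 1 M := IsManifold.of_le (n := ∞) (WithTop.coe_le_coe.mpr le_top)
  mdifferentiable_of_mem_atlas he

theorem chartD_bijective {e : OpenPartialHomeomorph M Plane} (he : e ∈ atlas Plane M) {q : M}
    (hq : q ∈ e.source) : Function.Bijective (chartD e q) :=
  (mdifferentiable_of_smooth he).mfderiv_bijective hq

theorem mfderiv_eq_fderiv_comp_symm {E : Type*} [NormedAddCommGroup E] [NormedSpace ℝ E]
    {f : M → E} {e : OpenPartialHomeomorph M Plane} (he : e ∈ atlas Plane M) {q : M}
    (hq : q ∈ e.source) (hf : DifferentiableAt ℝ (f ∘ e.symm) (e q))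
    (y : TangentSpace (𝓡 2) q) :
    mfderiv (𝓡 2) 𝓘(ℝ, E) f q y = fderiv ℝ (f ∘ e.symm) (e q) (chartD e q y) := by
  have heq : f =ᶠ[𝓝 q] (f ∘ e.symm) ∘ e := by
    filter_upwards [e.open_source.mem_nhds hq] with r hr
    simp [e.left_inv hr]
  rw [heq.mfderiv_eq, mfderiv_comp q hf.mdifferentiableAt
    ((mdifferentiable_of_smooth he).mdifferentiableAt hq), mfderiv_eq_fderiv]
  rfl

namespace IsOrientedSurface

variable {x N : M → Mink} {e : OpenPartialHomeomorph M Plane}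

theorem patch (hS : IsOrientedSurface x N) (he : e ∈ atlas Plane M) :
    IsSurfacePatch (x ∘ e.symm) (N ∘ e.symm) e.target := by
  have hX := contDiffOn_comp_symm hS.smooth he
  have hd : ∀ u ∈ e.target, ∀ y : TangentSpace (𝓡 2) (e.symm u),
      diffAt x (e.symm u) y = fderiv ℝ (x ∘ e.symm) u (chartD e (e.symm u) y) := by
    intro u hu y
    have h0 := hX.differentiableAt_of_isOpen e.open_target hu
    have := mfderiv_eq_fderiv_comp_symm he (e.map_target hu) (f := x)
      (by rwa [e.right_inv hu]) y
    rwa [e.right_inv hu] at this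
  exact
    { isOpen := e.open_target
      smooth_X := hX
      smooth_N := contDiffOn_comp_symm hS.smooth_normal he
      xx := fun u _ => (hS.mem (e.symm u)).1
      nn := fun u _ => hS.unit (e.symm u)
      xn := fun u _ => hS.tangent (e.symm u)
      injective := fun u hu y z hyz => by
        obtain ⟨y', rfl⟩ := (chartD_bijective he (e.map_target hu)).2 y
        obtain ⟨z', rfl⟩ := (chartD_bijective he (e.map_target hu)).2 z
        rw [← hd u hu, ← hd u hu] at hyz
        rw [hS.immersion _ hyz]
      normal := fun u hu y => by
        obtain ⟨y', rfl⟩ := (chartD_bijective he (e.map_target hu)).2 y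
        rw [← hd u hu]
        exact hS.normal _ _ }

theorem diffAt_x_eq (hS : IsOrientedSurface x N) (he : e ∈ atlas Plane M) {q : M}
    (hq : q ∈ e.source) (y : TangentSpace (𝓡 2) q) :
    diffAt x q y = fderiv ℝ (x ∘ e.symm) (e q) (chartD e q y) :=
  mfderiv_eq_fderiv_comp_symm he hq ((hS.patch he).diffAt_X (e.map_source hq)) y

theorem diffAt_N_eq (hS : IsOrientedSurface x N) (he : e ∈ atlas Plane M) {q : M}
    (hq : q ∈ e.source) (y : TangentSpace (𝓡 2) q) :
    diffAt N q y = fderiv ℝ (N ∘ e.symm) (e q) (chartD e q y) :=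
  mfderiv_eq_fderiv_comp_symm he hq ((hS.patch he).diffAt_N (e.map_source hq)) y

theorem isPrincipalCurvature_iff (hS : IsOrientedSurface x N) (he : e ∈ atlas Plane M) {q : M}
    (hq : q ∈ e.source) (κ : ℝ) :
    IsPrincipalCurvature x N q κ ↔ HasCurvature (x ∘ e.symm) (N ∘ e.symm) (e q) κ := by
  have hb := chartD_bijective he hq
  constructor
  · rintro ⟨y, hy, hκ⟩
    refine ⟨chartD e q y, fun h0 => hy (hb.1 (h0.trans (chartD_zero e q).symm)), ?_⟩
    rw [← hS.diffAt_N_eq he hq, ← hS.diffAt_x_eq he hq, hκ]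
  · rintro ⟨y, hy, hκ⟩
    obtain ⟨y, rfl⟩ := hb.2 y
    refine ⟨y, fun h0 => hy (by rw [h0, chartD_zero]), ?_⟩
    rw [hS.diffAt_N_eq he hq, hS.diffAt_x_eq he hq, hκ]

/-- A non-degenerate induced metric excludes umbilics, so there are exactly two principal
curvatures, and the infimum and supremum in `minCurvature` and `maxCurvature` are these two smooth
roots. -/
theorem setOf_isPrincipalCurvature (hS : IsOrientedSurface x N)
    (hT : IsMarginallyTrapped (normalGeodesics x N)) (he : e ∈ atlas Plane M) {u : Plane}
    (hu : u ∈ e.target) :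
    0 < pencilDisc (x ∘ e.symm) (N ∘ e.symm) u ∧
    {κ | IsPrincipalCurvature x N (e.symm u) κ} =
      {pencilRoot (x ∘ e.symm) (N ∘ e.symm) (-1) u, pencilRoot (x ∘ e.symm) (N ∘ e.symm) 1 u} := by
  have hd := (hS.patch he).pencilDisc_pos hu (hT.2 e he u hu).1
  refine ⟨hd, ?_⟩
  rw [← (hS.patch he).setOf_hasCurvature hu hd]
  ext κ
  have := hS.isPrincipalCurvature_iff he (e.map_target hu) κ
  rwa [e.right_inv hu] at this

theorem minCurvature_eq (hS : IsOrientedSurface x N)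
    (hT : IsMarginallyTrapped (normalGeodesics x N)) (he : e ∈ atlas Plane M) {u : Plane}
    (hu : u ∈ e.target) :
    minCurvature x N (e.symm u) = pencilRoot (x ∘ e.symm) (N ∘ e.symm) (-1) u := by
  obtain ⟨hd, hset⟩ := hS.setOf_isPrincipalCurvature hT he hu
  rw [minCurvature, hset, csInf_pair, inf_eq_left]
  exact ((hS.patch he).pencilRoot_lt hu hd).le

theorem maxCurvature_eq (hS : IsOrientedSurface x N)
    (hT : IsMarginallyTrapped (normalGeodesics x N)) (he : e ∈ atlas Plane M) {u : Plane}
    (hu : u ∈ e.target) :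
    maxCurvature x N (e.symm u) = pencilRoot (x ∘ e.symm) (N ∘ e.symm) 1 u := by
  obtain ⟨hd, hset⟩ := hS.setOf_isPrincipalCurvature hT he hu
  rw [maxCurvature, hset, csSup_pair, sup_eq_right]
  exact ((hS.patch he).pencilRoot_lt hu hd).le

theorem isPrincipalCurvature_min_max (hS : IsOrientedSurface x N)
    (hT : IsMarginallyTrapped (normalGeodesics x N)) (q : M) :
    IsPrincipalCurvature x N q (minCurvature x N q) ∧
      IsPrincipalCurvature x N q (maxCurvature x N q) := by
  have he := chart_mem_atlas Plane q
  have hq := mem_chart_source Plane q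
  set e := chartAt Plane q
  have hu := e.map_source hq
  obtain ⟨-, hset⟩ := hS.setOf_isPrincipalCurvature hT he hu
  have h1 := hS.minCurvature_eq hT he hu
  have h2 := hS.maxCurvature_eq hT he hu
  rw [← h1, ← h2, e.left_inv hq] at hset
  exact ⟨hset.ge (by simp), hset.ge (by simp)⟩

end IsOrientedSurface

end Charts

theorem IsPrincipalFrame.congr {X N : Plane → Mink} {k l k' l' : Plane → ℝ} {v w : Plane → Plane}
    {U : Set Plane} (h : IsPrincipalFrame X N k l v w U) (hk : EqOn k' k U) (hl : EqOn l' l U) :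
    IsPrincipalFrame X N k' l' v w U :=
  { h with
    smooth_k := h.smooth_k.congr hk
    smooth_l := h.smooth_l.congr hl
    shape_v := fun u hu => by rw [h.shape_v u hu, hk hu]
    shape_w := fun u hu => by rw [h.shape_w u hu, hl hu]
    ne := fun u hu => by rw [hk hu, hl hu]; exact h.ne u hu }

/-! ### Principal curvature functions on the surface and their lines of axes -/

section PrincipalPairs

variable {M : Type*} [TopologicalSpace M] [ChartedSpace Plane M]

/-- The functions `k` and `l` are the principal curvatures, in some order, and there are smooth
frames of principal directions around all points. -/
def IsCurvaturePair (x N : M → Mink) (k l : M → ℝ) : Prop :=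
  ∀ e ∈ atlas Plane M, ∀ u ∈ e.target, ∃ U ⊆ e.target, u ∈ U ∧ ∃ v w : Plane → Plane,
    IsPrincipalFrame (x ∘ e.symm) (N ∘ e.symm) (k ∘ e.symm) (l ∘ e.symm) v w U

theorem IsCurvaturePair.swap {x N : M → Mink} {k l : M → ℝ} (h : IsCurvaturePair x N k l) :
    IsCurvaturePair x N l k := by
  intro e he u hu
  obtain ⟨U, hU, huU, v, w, hf⟩ := h e he u hu
  exact ⟨U, hU, huU, w, v, hf.swap⟩

/-- The line (without its zero) of the bivectors of the osculating planes of the `k`-curvature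
lines, for surfaces with curvatures constant along these lines. -/
def axisLine (x N : M → Mink) (k l : M → ℝ) (q : M) : Set Bivector :=
  {β | ∃ y z : TangentSpace (𝓡 2) q, y ≠ 0 ∧ z ≠ 0 ∧
    diffAt N q y = -(k q • diffAt x q y) ∧ diffAt N q z = -(l q • diffAt x q z) ∧
    β = wedge (diffAt x q y) ((mink (diffAt x q z) (diffAt x q z) * (l q - k q)) •
      (x q + k q • N q) - realDiffAt k q z • diffAt x q z)}

/-- The line of bivectors `axisLine` of a surface patch. -/
def patchLine (X N : Plane → Mink) (k l : Plane → ℝ) (u : Plane) : Set Bivector :=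
  {β | ∃ y z : Plane, y ≠ 0 ∧ z ≠ 0 ∧
    fderiv ℝ N u y = -(k u • fderiv ℝ X u y) ∧ fderiv ℝ N u z = -(l u • fderiv ℝ X u z) ∧
    β = wedge (fderiv ℝ X u y) ((mink (fderiv ℝ X u z) (fderiv ℝ X u z) * (l u - k u)) •
      (X u + k u • N u) - fderiv ℝ k u z • fderiv ℝ X u z)}

namespace IsPrincipalFrame

variable {X N : Plane → Mink} {k l : Plane → ℝ} {v w : Plane → Plane} {U : Set Plane} {u : Plane}

theorem principal_iff (h : IsPrincipalFrame X N k l v w U) (hu : u ∈ U) (y : Plane) :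
    fderiv ℝ N u y = -(k u • fderiv ℝ X u y) ↔ ∃ c : ℝ, y = c • v u := by
  have hv : fderiv ℝ N u (v u) = -(k u • fderiv ℝ X u (v u)) := h.shape_v u hu
  have hw : fderiv ℝ N u (w u) = -(l u • fderiv ℝ X u (w u)) := h.shape_w u hu
  constructor
  · intro hy
    have hexp := h.expand hu y
    set α := mink (fderiv ℝ X u y) (dirD v X u)
    set β := mink (fderiv ℝ X u y) (dirD w X u)
    rw [hexp] at hy
    simp only [map_add, map_smul, hv, hw] at hy
    have h1 := congrArg (fun z => mink z (dirD w X u)) hy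
    change mink (α • -(k u • dirD v X u) + β • -(l u • dirD w X u)) (dirD w X u) =
      mink (-(k u • (α • dirD v X u + β • dirD w X u))) (dirD w X u) at h1
    simp only [mink_add_left, mink_smul_left, mink_neg_left, h.ef u hu, h.ff u hu] at h1
    have h2 : (l u - k u) * β = 0 := by linarith
    have hβ : β = 0 := (mul_eq_zero.mp h2).resolve_left (sub_ne_zero.mpr (h.ne u hu).symm)
    exact ⟨α, by rw [hexp, hβ, zero_smul, add_zero]⟩
  · rintro ⟨c, rfl⟩
    rw [map_smul, map_smul, hv]
    module

theorem v_ne_zero (h : IsPrincipalFrame X N k l v w U) (hu : u ∈ U) : v u ≠ 0 := by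
  intro h0
  have := h.ee u hu
  rw [dirD, h0, map_zero, mink_zero_left] at this
  exact zero_ne_one this

/-- By Codazzi, `(l - k)(X + k N) - w(k) f = (l - k) ∇_v e`, so the set is the punctured line of the
axis. Its definition uses arbitrary eigenvectors and the differential of `k` only, hence does not
depend on a choice of frame; rescaling the eigenvectors by `s` and `r` multiplies the bivector by `s
r²`. -/
theorem patchLine_eq (h : IsPrincipalFrame X N k l v w U) (hu : u ∈ U) :
    patchLine X N k l u = {β | ∃ c : ℝ, c ≠ 0 ∧ β = c • axis X v u} := by
  have hlk : l u - k u ≠ 0 := sub_ne_zero.mpr (h.ne u hu).symm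
  have key : ∀ s r : ℝ, wedge (fderiv ℝ X u (s • v u))
      ((mink (fderiv ℝ X u (r • w u)) (fderiv ℝ X u (r • w u)) * (l u - k u)) •
        (X u + k u • N u) - fderiv ℝ k u (r • w u) • fderiv ℝ X u (r • w u)) =
      (s * (r ^ 2 * (l u - k u))) • axis X v u := by
    intro s r
    have h1 : fderiv ℝ X u (r • w u) = r • dirD w X u := map_smul _ _ _
    have h2 : fderiv ℝ X u (s • v u) = s • dirD v X u := map_smul _ _ _
    have h3 : fderiv ℝ k u (r • w u) = r * dirD w k u := map_smul _ _ _
    have h4 : (r * (r * 1) * (l u - k u)) • (X u + k u • N u) -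
        (r * (geodCurv X v w u * (l u - k u))) • r • dirD w X u =
        (r ^ 2 * (l u - k u)) • dirD v (dirD v X) u := by
      rw [h.dirD_e_frame hu]
      module
    rw [h1, h2, h3, mink_smul_left, mink_smul_right, h.ff u hu, h.codazzi hu, h4,
      wedge_smul_left, wedge_smul_right, smul_smul]
    rfl
  ext β
  constructor
  · rintro ⟨y, z, hy, hz, hyk, hzl, rfl⟩
    obtain ⟨s, rfl⟩ := (h.principal_iff hu y).mp hyk
    obtain ⟨r, rfl⟩ := (h.swap.principal_iff hu z).mp hzl
    have hs : s ≠ 0 := fun h0 => hy (by rw [h0, zero_smul])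
    have hr : r ≠ 0 := fun h0 => hz (by rw [h0, zero_smul])
    exact ⟨s * (r ^ 2 * (l u - k u)), mul_ne_zero hs (mul_ne_zero (pow_ne_zero 2 hr) hlk),
      key s r⟩
  · rintro ⟨c, hc, rfl⟩
    refine ⟨(c / (l u - k u)) • v u, (1 : ℝ) • w u,
      smul_ne_zero (div_ne_zero hc hlk) (h.v_ne_zero hu), ?_,
      (h.principal_iff hu _).mpr ⟨_, rfl⟩, (h.swap.principal_iff hu _).mpr ⟨_, rfl⟩, ?_⟩
    · rw [one_smul]; exact h.swap.v_ne_zero hu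
    · rw [key]
      congr 1
      field_simp

/-- If both curvatures are constant along the `v`-curves, the lines are locally constant. -/
theorem patchLine_eventually (h : IsPrincipalFrame X N k l v w U)
    (hk : ∀ p ∈ U, dirD v k p = 0) (hl : ∀ p ∈ U, dirD v l p = 0) (hu : u ∈ U) :
    ∀ᶠ p in 𝓝 u, patchLine X N k l p = patchLine X N k l u := by
  filter_upwards [h.axis_eventually hk hl hu, h.isOpen.mem_nhds hu] with p ⟨c, hc, hp⟩ hpU
  rw [h.patchLine_eq hpU, h.patchLine_eq hu, hp]
  ext β
  constructor
  · rintro ⟨d, hd, rfl⟩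
    exact ⟨d * c, mul_ne_zero hd hc, smul_smul _ _ _⟩
  · rintro ⟨d, hd, rfl⟩
    exact ⟨d / c, div_ne_zero hd hc, by rw [smul_smul, div_mul_cancel₀ _ hc]⟩

end IsPrincipalFrame

variable [IsManifold (𝓡 2) ∞ M] {x N : M → Mink} {k l : M → ℝ}

theorem IsOrientedSurface.isCurvaturePair (hS : IsOrientedSurface x N)
    (hT : IsMarginallyTrapped (normalGeodesics x N)) :
    IsCurvaturePair x N (minCurvature x N) (maxCurvature x N) := by
  intro e he u hu
  obtain ⟨U, hU, huU, v, w, hf⟩ := (hS.patch he).exists_principalFrame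
    (fun p hp => (hS.setOf_isPrincipalCurvature hT he hp).1) hu
  exact ⟨U, hU, huU, v, w, hf.congr (fun p hp => hS.minCurvature_eq hT he (hU hp))
    (fun p hp => hS.maxCurvature_eq hT he (hU hp))⟩

theorem IsCurvaturePair.realDiffAt_eq (hP : IsCurvaturePair x N k l)
    {e : OpenPartialHomeomorph M Plane} (he : e ∈ atlas Plane M) {q : M} (hq : q ∈ e.source)
    (y : TangentSpace (𝓡 2) q) :
    realDiffAt k q y = fderiv ℝ (k ∘ e.symm) (e q) (chartD e q y) := by
  obtain ⟨U, -, huU, v, w, hf⟩ := hP e he _ (e.map_source hq)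
  exact mfderiv_eq_fderiv_comp_symm he hq (hf.diffAt_k huU) y

theorem IsCurvaturePair.axisLine_eq (hP : IsCurvaturePair x N k l) (hS : IsOrientedSurface x N)
    {e : OpenPartialHomeomorph M Plane} (he : e ∈ atlas Plane M) {q : M} (hq : q ∈ e.source) :
    axisLine x N k l q = patchLine (x ∘ e.symm) (N ∘ e.symm) (k ∘ e.symm) (l ∘ e.symm) (e q) := by
  have hb := chartD_bijective he hq
  have hne : ∀ y : TangentSpace (𝓡 2) q, y ≠ 0 ↔ chartD e q y ≠ 0 := fun y => by
    rw [ne_eq, ne_eq, ← hb.1.eq_iff, chartD_zero]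
  ext β
  simp only [axisLine, patchLine, mem_ofPred_eq, Function.comp_apply, e.left_inv hq]
  constructor
  · rintro ⟨y, z, hy, hz, h1, h2, h3⟩
    refine ⟨chartD e q y, chartD e q z, (hne y).mp hy, (hne z).mp hz, ?_⟩
    simpa only [hS.diffAt_x_eq he hq, hS.diffAt_N_eq he hq, hP.realDiffAt_eq he hq]
      using And.intro h1 (And.intro h2 h3)
  · rintro ⟨y, z, hy, hz, h1, h2, h3⟩
    obtain ⟨y, rfl⟩ := hb.2 y
    obtain ⟨z, rfl⟩ := hb.2 z
    refine ⟨y, z, (hne y).mpr hy, (hne z).mpr hz, ?_⟩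
    simpa only [hS.diffAt_x_eq he hq, hS.diffAt_N_eq he hq, hP.realDiffAt_eq he hq]
      using And.intro h1 (And.intro h2 h3)

end PrincipalPairs

/-! ## Decompositions into open sets and locally constant functions -/

/-- The open set of points near which `φ` is constant. -/
def constLocus {X α : Type*} [TopologicalSpace X] (φ : X → α) : Set X :=
  {p | ∀ᶠ q in 𝓝 p, φ q = φ p}

theorem isOpen_constLocus {X α : Type*} [TopologicalSpace X] (φ : X → α) :
    IsOpen (constLocus φ) := by
  rw [isOpen_iff_mem_nhds]
  intro p hp
  have hp' : ∀ᶠ q in 𝓝 p, φ q = φ p := hp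
  filter_upwards [hp', eventually_eventually_nhds.mpr hp'] with q hq hqq
  change ∀ᶠ r in 𝓝 q, φ r = φ q
  filter_upwards [hqq] with r hr
  rw [hr, hq]

/-- With the discrete topology on the target, `φ` is continuous at each point of `V`, hence constant
on this preconnected set. No structure on the target is needed, so the result applies to line-valued
functions as well as to curvatures. -/
theorem eq_of_subset_constLocus {X α : Type*} [TopologicalSpace X] {φ : X → α} {V : Set X}
    (hV : IsPreconnected V) (hsub : V ⊆ constLocus φ) {p q : X} (hp : p ∈ V) (hq : q ∈ V) :
    φ p = φ q := by
  let _ : TopologicalSpace α := ⊥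
  have _ : DiscreteTopology α := ⟨rfl⟩
  refine hV.constant (fun r hr => ?_) hp hq
  have hr' : φ =ᶠ[𝓝 r] fun _ => φ r := hsub hr
  exact (continuousAt_const.congr hr'.symm).continuousWithinAt

/-- Open sets with dense union can be shrunk to disjoint open sets with dense union. -/
theorem exists_dense_components {X ι : Type*} [TopologicalSpace X] [LinearOrder ι]
    [WellFoundedLT ι] (A : ι → Set X) (hA : ∀ i, IsOpen (A i)) (hd : Dense (⋃ i, A i)) :
    ∃ W : Set X, IsOpen W ∧ Dense W ∧ ∀ p ∈ W, ∃ i, connectedComponentIn W p ⊆ A i := by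
  -- Removing the closure of the earlier sets makes the pieces disjoint while keeping them open.
  let B : ι → Set X := fun i => A i \ closure (⋃ j, ⋃ (_ : j < i), A j)
  have hBo : ∀ i, IsOpen (B i) := fun i => (hA i).sdiff isClosed_closure
  have hdisj : ∀ i j, i < j → Disjoint (B i) (B j) := by
    intro i j hij
    rw [Set.disjoint_left]
    intro p hpi hpj
    exact hpj.2 (subset_closure (mem_iUnion₂.mpr ⟨i, hij, hpi.1⟩))
  refine ⟨⋃ i, B i, isOpen_iUnion hBo, ?_, ?_⟩
  · rw [dense_iff_inter_open] at hd ⊢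
    intro O hO hne
    have hex : ∃ i, (O ∩ A i).Nonempty := by
      obtain ⟨p, hpO, hp⟩ := hd O hO hne
      obtain ⟨i, hi⟩ := mem_iUnion.mp hp
      exact ⟨i, p, hpO, hi⟩
    -- For the least index whose set meets `O`, a point of `O` in this set cannot lie in the closure
    -- of the earlier ones, for then `O` would meet one of those.
    obtain ⟨i, ⟨p, hpO, hpi⟩, hmin⟩ := WellFounded.has_min (wellFounded_lt (α := ι))
      {i | (O ∩ A i).Nonempty} hex
    refine ⟨p, hpO, mem_iUnion.mpr ⟨i, hpi, fun hcl => ?_⟩⟩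
    obtain ⟨r, hrO, hr⟩ := mem_closure_iff.mp hcl O hO hpO
    obtain ⟨j, hji, hrj⟩ := mem_iUnion₂.mp hr
    exact hmin j ⟨r, hrO, hrj⟩ hji
  · intro p hp
    obtain ⟨i, hi⟩ := mem_iUnion.mp hp
    refine ⟨i, ?_⟩
    have hsub : connectedComponentIn (⋃ i, B i) p ⊆ B i ∪ ⋃ j, ⋃ (_ : j ≠ i), B j := by
      intro r hr
      obtain ⟨j, hj⟩ := mem_iUnion.mp (connectedComponentIn_subset _ _ hr)
      by_cases hji : j = i
      · exact Or.inl (hji ▸ hj)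
      · exact Or.inr (mem_iUnion₂.mpr ⟨j, hji, hj⟩)
    have hdis : Disjoint (B i) (⋃ j, ⋃ (_ : j ≠ i), B j) := by
      rw [disjoint_iUnion₂_right]
      intro j hj
      rcases lt_or_gt_of_ne hj with h | h
      · exact (hdisj j i h).symm
      · exact hdisj i j h
    exact (isPreconnected_connectedComponentIn.subset_left_of_subset_union (hBo i)
      (isOpen_iUnion fun j => isOpen_iUnion fun _ => hBo j) hdis hsub
      ⟨p, mem_connectedComponentIn hp, hi⟩).trans sdiff_subset

/-- If a product vanishes on an open set, one of the factors vanishes on a smaller open set. -/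
theorem exists_isOpen_eq_zero {X : Type*} [TopologicalSpace X] {U : Set X} (hU : IsOpen U)
    {u : X} (hu : u ∈ U) {f g : X → ℝ} (hf : ContinuousOn f U)
    (hfg : ∀ p ∈ U, f p = 0 ∨ g p = 0) :
    ∃ U' ⊆ U, IsOpen U' ∧ U'.Nonempty ∧ ((∀ p ∈ U', f p = 0) ∨ ∀ p ∈ U', g p = 0) := by
  by_cases h : ∀ p ∈ U, f p = 0
  · exact ⟨U, Subset.rfl, hU, ⟨u, hu⟩, Or.inl h⟩
  · push Not at h
    obtain ⟨p, hp, hfp⟩ := h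
    exact ⟨U ∩ f ⁻¹' {0}ᶜ, inter_subset_left, hf.isOpen_inter_preimage hU isOpen_compl_singleton,
      ⟨p, hp, hfp⟩, Or.inr fun q hq => (hfg q hq.1).resolve_left hq.2⟩

theorem IsPrincipalFrame.const_of_dirD_eq_zero {X N : Plane → Mink} {k l : Plane → ℝ}
    {v w : Plane → Plane} {U : Set Plane} (h : IsPrincipalFrame X N k l v w U)
    (hv : ∀ p ∈ U, dirD v k p = 0) (hw : ∀ p ∈ U, dirD w k p = 0) {u : Plane} (hu : u ∈ U) :
    ∀ᶠ p in 𝓝 u, k p = k u := by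
  obtain ⟨r, hr, hball⟩ := Metric.isOpen_iff.mp h.isOpen u hu
  filter_upwards [Metric.ball_mem_nhds u hr] with p hp
  refine (convex_ball u r).is_const_of_fderivWithin_eq_zero (𝕜 := ℝ)
    (fun q hq => (h.diffAt_k (hball hq)).differentiableWithinAt) (fun q hq => ?_) hp
    (Metric.mem_ball_self hr)
  rw [fderivWithin_of_isOpen Metric.isOpen_ball hq]
  ext1 y
  rw [h.expand (hball hq) y, map_add, map_smul, map_smul]
  change _ • dirD v k q + _ • dirD w k q = 0
  rw [hv q (hball hq), hw q (hball hq)]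
  simp

/-! ### Local constancy of a curvature or of an axis on a dense set -/

section Surfaces

variable {M : Type*} [TopologicalSpace M] [ChartedSpace Plane M] [IsManifold (𝓡 2) ∞ M]
  {x N : M → Mink} {k l : M → ℝ}

theorem IsCurvaturePair.mem_axisLocus (hP : IsCurvaturePair x N k l)
    (hS : IsOrientedSurface x N) {e : OpenPartialHomeomorph M Plane} (he : e ∈ atlas Plane M)
    {U : Set Plane} (hU : U ⊆ e.target) {v w : Plane → Plane}
    (hf : IsPrincipalFrame (x ∘ e.symm) (N ∘ e.symm) (k ∘ e.symm) (l ∘ e.symm) v w U)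
    (hk : ∀ p ∈ U, dirD v (k ∘ e.symm) p = 0) (hl : ∀ p ∈ U, dirD v (l ∘ e.symm) p = 0)
    {u : Plane} (hu : u ∈ U) : e.symm u ∈ constLocus (axisLine x N k l) := by
  apply eventually_of_chart (hU hu)
  filter_upwards [hf.patchLine_eventually hk hl hu, hf.isOpen.mem_nhds hu] with p hp hpU
  rw [hP.axisLine_eq hS he (e.map_target (hU hpU)), hP.axisLine_eq hS he (e.map_target (hU hu)),
    e.right_inv (hU hpU), e.right_inv (hU hu), hp]

/-- The principal curvatures and the axes. One of these functions is constant near the points of an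
open dense set. -/
theorem IsOrientedSurface.dense_constLocus (hS : IsOrientedSurface x N) (hW : IsWeingarten x N)
    (hT : IsMarginallyTrapped (normalGeodesics x N)) :
    Dense (⋃ i : Fin 4, ![constLocus (minCurvature x N), constLocus (maxCurvature x N),
      constLocus (axisLine x N (minCurvature x N) (maxCurvature x N)),
      constLocus (axisLine x N (maxCurvature x N) (minCurvature x N))] i) := by
  have hP := hS.isCurvaturePair hT
  rw [dense_iff_inter_open]
  rintro O hO ⟨q, hqO⟩
  have he := chart_mem_atlas Plane q
  have hq := mem_chart_source Plane q
  set e := chartAt Plane q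
  obtain ⟨U, hU, huU, v, w, hf⟩ := hP e he _ (e.map_source hq)
  set K := minCurvature x N ∘ e.symm with hK
  set L := maxCurvature x N ∘ e.symm with hL
  have hOU : IsOpen (U ∩ (e.target ∩ e.symm ⁻¹' O)) :=
    hf.isOpen.inter (e.isOpen_inter_preimage_symm hO)
  replace hf := hf.mono hOU inter_subset_left
  have huO : e q ∈ U ∩ (e.target ∩ e.symm ⁻¹' O) :=
    ⟨huU, hU huU, by rwa [mem_preimage, e.left_inv hq]⟩
  have hVO : ∀ u ∈ U ∩ (e.target ∩ e.symm ⁻¹' O), e.symm u ∈ O := fun u hu => hu.2.2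
  have hVt : U ∩ (e.target ∩ e.symm ⁻¹' O) ⊆ e.target := fun u hu => hu.2.1
  generalize U ∩ (e.target ∩ e.symm ⁻¹' O) = V at hf huO hVO hVt
  have hprod : ∀ u ∈ V, dirD v L u = 0 ∨ dirD w K u = 0 := by
    intro u hu
    obtain ⟨-, H, hH, hnull⟩ := hT.2 e he u (hVt hu)
    exact hf.dirD_mul_dirD_eq_zero hu hH hnull
  have hwein : ∀ u ∈ V, dirD v K u = 0 ∨ dirD w L u = 0 := by
    intro u hu
    have hs := e.map_target (hVt hu)
    obtain ⟨y, hy⟩ := (chartD_bijective he hs).2 (v u)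
    obtain ⟨z, hz⟩ := (chartD_bijective he hs).2 (w u)
    have h1 := hW (e.symm u) y z
    simp only [hP.realDiffAt_eq he hs, hP.swap.realDiffAt_eq he hs, hy, hz,
      e.right_inv (hVt hu)] at h1
    change dirD v K u * dirD w L u = dirD w K u * dirD v L u at h1
    -- Marginal trapping makes one side of the Weingarten identity vanish, hence also the other
    -- side.
    have h2 : dirD w K u * dirD v L u = 0 := by
      rcases hprod u hu with h | h <;> rw [h] <;> ring
    exact mul_eq_zero.mp (h1.trans h2)
  have dK := hf.smooth_k
  have dL := hf.smooth_l
  -- Two successive shrinkings make one fixed factor of each of the two products vanish identically.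
  obtain ⟨V₁, hV₁, ho₁, ⟨u₁, hu₁⟩, h₁⟩ := exists_isOpen_eq_zero hf.isOpen huO
    (dL.dirD hf.smooth_v hf.isOpen).continuousOn hprod
  obtain ⟨V₂, hV₂, ho₂, ⟨u₂, hu₂⟩, h₂⟩ := exists_isOpen_eq_zero ho₁ hu₁
    ((dK.dirD hf.smooth_v hf.isOpen).continuousOn.mono hV₁) (fun p hp => hwein p (hV₁ hp))
  replace hf := hf.mono ho₂ (hV₂.trans hV₁)
  have hV₂t := (hV₂.trans hV₁).trans hVt
  refine ⟨e.symm u₂, hVO u₂ (hV₁ (hV₂ hu₂)), mem_iUnion.mpr ?_⟩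
  -- If the vanishing derivatives belong to the same curvature, it is locally constant. If they are
  -- in the same direction, both curvatures are constant along that family of lines and the axis is
  -- locally constant.
  rcases h₁ with h₁ | h₁ <;> rcases h₂ with h₂ | h₂
  · exact ⟨2, hP.mem_axisLocus hS he hV₂t hf h₂ (fun p hp => h₁ p (hV₂ hp)) hu₂⟩
  · exact ⟨1, eventually_of_chart (hV₂t hu₂)
      (hf.swap.const_of_dirD_eq_zero h₂ (fun p hp => h₁ p (hV₂ hp)) hu₂)⟩
  · exact ⟨0, eventually_of_chart (hV₂t hu₂)
      (hf.const_of_dirD_eq_zero h₂ (fun p hp => h₁ p (hV₂ hp)) hu₂)⟩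
  · exact ⟨3, hP.swap.mem_axisLocus hS he hV₂t hf.swap h₂ (fun p hp => h₁ p (hV₂ hp)) hu₂⟩

/-! ## Surfaces of revolution -/

theorem IsCurvaturePair.exists_mem_axisLine (hP : IsCurvaturePair x N k l)
    (hS : IsOrientedSurface x N) (q : M) : (axisLine x N k l q).Nonempty := by
  have hq := mem_chart_source Plane q
  obtain ⟨U, -, huU, v, w, hf⟩ := hP _ (chart_mem_atlas Plane q) _
    ((chartAt Plane q).map_source hq)
  rw [hP.axisLine_eq hS (chart_mem_atlas Plane q) hq, hf.patchLine_eq huU]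
  exact ⟨_, 1, one_ne_zero, rfl⟩

/-- The Killing fields of the axes are tangent to the surface. -/
theorem IsCurvaturePair.mink_contract_eq_zero (hP : IsCurvaturePair x N k l)
    (hS : IsOrientedSurface x N) {q : M} {β : Bivector} (hβ : β ∈ axisLine x N k l q) :
    mink (contract β (x q)) (N q) = 0 := by
  have hq := mem_chart_source Plane q
  obtain ⟨U, -, huU, v, w, hf⟩ := hP _ (chart_mem_atlas Plane q) _
    ((chartAt Plane q).map_source hq)
  rw [hP.axisLine_eq hS (chart_mem_atlas Plane q) hq, hf.patchLine_eq huU] at hβ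
  obtain ⟨c, -, rfl⟩ := hβ
  have h1 := hf.contract_axis huU
  have h2 := (hf.frame huU).en
  rw [← h1] at h2
  simp only [Function.comp_apply, (chartAt Plane q).left_inv hq] at h2
  have h3 : ∀ γ, contract (c • γ) (x q) = c • contract γ (x q) := fun γ => by
    ext i
    fin_cases i <;> simp [contract] <;> ring
  rw [h3, mink_smul_left, h2, mul_zero]

theorem IsCurvaturePair.isRotationGroup (hP : IsCurvaturePair x N k l)
    (hS : IsOrientedSurface x N) {q : M} {β : Bivector} (hβ : β ∈ axisLine x N k l q) :
    IsRotationGroup fun t => NormedSpace.exp (t • contractL β) := by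
  have hq := mem_chart_source Plane q
  obtain ⟨U, -, huU, v, w, hf⟩ := hP _ (chart_mem_atlas Plane q) _
    ((chartAt Plane q).map_source hq)
  rw [hP.axisLine_eq hS (chart_mem_atlas Plane q) hq, hf.patchLine_eq huU] at hβ
  obtain ⟨c, hc, rfl⟩ := hβ
  have hfr := hf.frame huU
  rw [IsPrincipalFrame.axis, ← wedge_smul_left]
  -- The dual vectors are `e` and `X`: `e` is orthogonal to `∇_v e`, while `X` is orthogonal to `e`
  -- and has product `-1` with `∇_v e`.
  refine isRotationGroup_exp (y := dirD v (x ∘ (chartAt Plane q).symm) (chartAt Plane q q))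
    (z := (x ∘ (chartAt Plane q).symm) (chartAt Plane q q)) ?_ ?_ ?_ ?_
  · rwa [mink_smul_right, hfr.ee, mul_one]
  · rw [hf.dirD_e_frame huU, mink_add_right, mink_sub_right, mink_smul_right, mink_smul_right,
      mink_comm, hfr.xe, hfr.ef, hfr.en]
    ring
  · rw [mink_smul_right, hfr.xe, mul_zero]
  · rw [hf.dirD_e_frame huU, mink_add_right, mink_sub_right, mink_smul_right, mink_smul_right,
      hfr.xx, hfr.xf, hfr.xn]
    norm_num

/-- A surface to which the Killing field of a group of rotations is tangent is a surface of
revolution. -/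
theorem IsCurvaturePair.isSurfaceOfRevolution (hP : IsCurvaturePair x N k l)
    (hS : IsOrientedSurface x N) {p : M} {β : Bivector} (hβ : β ∈ axisLine x N k l p)
    {V : Set M} (hV : IsOpen V) (htan : ∀ q ∈ V, mink (contract β (x q)) (N q) = 0) :
    IsSurfaceOfRevolution x V := by
  refine ⟨_, hP.isRotationGroup hS hβ, fun q hqV => ?_⟩
  have he := chart_mem_atlas Plane q
  have hq := mem_chart_source Plane q
  set e := chartAt Plane q
  obtain ⟨U, hU, huU, v, w, hf⟩ := hP e he _ (e.map_source hq)
  set X := x ∘ e.symm with hX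
  have hOU : IsOpen (U ∩ (e.target ∩ e.symm ⁻¹' V)) :=
    hf.isOpen.inter (e.isOpen_inter_preimage_symm hV)
  have huV : e q ∈ U ∩ (e.target ∩ e.symm ⁻¹' V) :=
    ⟨huU, hU huU, by rwa [mem_preimage, e.left_inv hq]⟩
  set U' := U ∩ (e.target ∩ e.symm ⁻¹' V) with hU'
  have hcX : ContDiffOn ℝ ∞ (fun u => contract β (X u)) U :=
    (contractL β).contDiff.comp_contDiffOn hf.smooth_X
  -- The pullback of the Killing field to the parameter plane; it maps back to the full Killing
  -- field because the latter has no component along `X` (skewness) or `N` (tangency).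
  let Y : Plane → Plane := fun u =>
    mink (contract β (X u)) (dirD v X u) • v u + mink (contract β (X u)) (dirD w X u) • w u
  have hY : ContDiffOn ℝ ∞ Y U :=
    ((hcX.mink hf.smooth_e).smul hf.smooth_v).add ((hcX.mink hf.swap.smooth_e).smul hf.smooth_w)
  have hXY : ∀ u ∈ U', fderiv ℝ X u (Y u) = contractL β (X u) := by
    intro u hu
    have h1 : mink (contract β (X u)) (X u) = 0 := by
      have := mink_contract β (X u) (X u)
      rw [mink_comm (X u)] at this
      linarith
    have h2 : mink (contract β (X u)) ((N ∘ e.symm) u) = 0 := htan _ hu.2.2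
    rw [map_add, map_smul, map_smul, contractL_apply]
    conv_rhs => rw [(hf.frame hu.1).expand (contract β (X u)), h1, h2]
    simp [dirD]
  -- An integral curve of the pulled-back field, by Picard–Lindelöf.
  obtain ⟨α, hα0, ε, hε, hα⟩ : ∃ α : ℝ → Plane, α 0 = e q ∧ ∃ ε > 0,
      ∀ t ∈ Ioo (0 - ε) (0 + ε), HasDerivAt α (Y (α t)) t :=
    ((hY.contDiffAt (hf.isOpen.mem_nhds huU)).of_le (by exact_mod_cast le_top)
      ).exists_forall_mem_closedBall_exists_eq_forall_mem_Ioo_hasDerivAt₀ 0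
  simp only [zero_sub, zero_add] at hα
  have hcont : ContinuousAt α 0 := (hα 0 ⟨by linarith, hε⟩).continuousAt
  obtain ⟨δ, hδ, hball⟩ := Metric.eventually_nhds_iff_ball.mp
    (hcont.eventually_mem (hOU.mem_nhds (by rwa [hα0])))
  rw [Real.ball_eq_Ioo, zero_sub, zero_add] at hball
  have hsub : ∀ t ∈ Ioo (-min ε δ) (min ε δ), t ∈ Ioo (-ε) ε ∧ α t ∈ U' := fun t ht =>
    ⟨⟨by linarith [ht.1, min_le_left ε δ], by linarith [ht.2, min_le_left ε δ]⟩,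
      hball t ⟨by linarith [ht.1, min_le_right ε δ], by linarith [ht.2, min_le_right ε δ]⟩⟩
  refine ⟨min ε δ, lt_min hε hδ, fun t => e.symm (α t), ?_, ?_, fun t ht => ⟨?_, ?_⟩⟩
  · simp only [hα0, e.left_inv hq]
  · intro t ht
    exact ((e.symm.continuousAt (hsub t ht).2.2.1).comp
      (hα t (hsub t ht).1).continuousAt).continuousWithinAt
  · exact (hsub t ht).2.2.2
  -- The image of the integral curve solves the linear equation of the one-parameter group, so by
  -- uniqueness it is the orbit of the initial point.
  · have hode : ∀ s ∈ Ioo (-min ε δ) (min ε δ),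
        HasDerivAt (fun s => X (α s)) (contractL β (X (α s))) s := by
      intro s hs
      have h1 := (hf.diffAt_X (hsub s hs).2.1).hasFDerivAt.comp_hasDerivAt s (hα s (hsub s hs).1)
      rw [hXY _ (hsub s hs).2] at h1
      exact h1
    have h2 := eq_exp_smul_apply hode ht
    simpa [hX, hα0, e.left_inv hq] using h2

/-! ## Analytic surfaces -/

/-- A condition given locally by the zeros of analytic functions holds everywhere on a connected
surface if it holds near some point. -/
theorem forall_of_eventually_of_analytic {M : Type*} [TopologicalSpace M] [ChartedSpace Plane M]
    [PreconnectedSpace M] {P : M → Prop}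
    (hP : ∀ e ∈ atlas Plane M, ∃ φ : Plane → ℝ, AnalyticOnNhd ℝ φ e.target ∧
      ∀ u ∈ e.target, P (e.symm u) ↔ φ u = 0) {p : M} (hp : ∀ᶠ q in 𝓝 p, P q) (q : M) : P q := by
  have hopen : IsOpen {p | ∀ᶠ q in 𝓝 p, P q} := isOpen_setOfPred_eventually_nhds
  have hclosed : IsClosed {p | ∀ᶠ q in 𝓝 p, P q} := by
    rw [← closure_subset_iff_isClosed]
    intro r hr
    have he := chart_mem_atlas Plane r
    have hrs := mem_chart_source Plane r
    set e := chartAt Plane r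
    obtain ⟨φ, hφ, hPφ⟩ := hP e he
    -- The chart domain need not be connected, so the identity theorem is applied on a ball around
    -- the limit point.
    obtain ⟨δ, hδ, hball⟩ := Metric.isOpen_iff.mp e.open_target _ (e.map_source hrs)
    have hopenB : IsOpen (e.source ∩ e ⁻¹' Metric.ball (e r) δ) :=
      e.isOpen_inter_preimage Metric.isOpen_ball
    obtain ⟨s, ⟨hss, hsB⟩, hs⟩ := mem_closure_iff.mp hr _ hopenB ⟨hrs, Metric.mem_ball_self hδ⟩
    have hs' : ∀ᶠ q in 𝓝 s, P q := hs
    have hev : φ =ᶠ[𝓝 (e s)] 0 := by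
      have h1 : Filter.Tendsto e.symm (𝓝 (e s)) (𝓝 s) := by
        have := e.symm.continuousAt (e.map_source hss)
        rwa [ContinuousAt, e.left_inv hss] at this
      filter_upwards [h1.eventually hs', e.open_target.mem_nhds (e.map_source hss)] with u hu hut
      exact (hPφ u hut).mp hu
    have hzero := (hφ.mono hball).eqOn_zero_of_preconnected_of_eventuallyEq_zero
      (convex_ball _ _).isPreconnected hsB hev
    change ∀ᶠ q in 𝓝 r, P q
    filter_upwards [hopenB.mem_nhds ⟨hrs, Metric.mem_ball_self hδ⟩] with q ⟨hqs, hqB⟩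
    have := (hPφ (e q) (e.map_source hqs)).mpr (hzero hqB)
    rwa [e.left_inv hqs] at this
  have huniv := IsClopen.eq_univ ⟨hclosed, hopen⟩ ⟨p, hp⟩
  have hq : q ∈ {p | ∀ᶠ q in 𝓝 p, P q} := by rw [huniv]; trivial
  exact Filter.Eventually.self_of_nhds hq

theorem ContDiffOn.analyticOnNhd_of_isOpen {φ : Plane → ℝ} {U : Set Plane} (hU : IsOpen U)
    (hφ : ContDiffOn ℝ ω φ U) : AnalyticOnNhd ℝ φ U :=
  hU.analyticOn_iff_analyticOnNhd.mp hφ.analyticOn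

theorem contDiffOn_charPencil {X N : Plane → Mink} {U : Set Plane} (hU : IsOpen U)
    (hX : ContDiffOn ℝ ω X U) (hN : ContDiffOn ℝ ω N U) (κ : ℝ) :
    ContDiffOn ℝ ω (charPencil X N κ) U := by
  have hd : ∀ {f : Plane → Mink}, ContDiffOn ℝ ω f U → ∀ y,
      ContDiffOn ℝ ω (fun u => fderiv ℝ f u y) U := fun hf y =>
    (hf.fderiv_of_isOpen hU (m := ω) (by simp)).clm_apply contDiffOn_const
  have hp : ∀ i j, ContDiffOn ℝ ω (pencil X N κ i j) U := fun i j =>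
    ((hd hN _).mink (hd hX _)).neg.sub (contDiffOn_const.mul ((hd hX _).mink (hd hX _)))
  exact ((hp 0 0).mul (hp 1 1)).sub ((hp 0 1).pow 2)

/-- In a chart the condition is the vanishing of `charPencil` at the fixed value `c`. This is a
polynomial in the first derivatives of `x` and `N`, so it is analytic without any choice of a root.
-/
theorem IsOrientedSurface.isPrincipalCurvature_of_eventually [PreconnectedSpace M]
    [IsManifold (𝓡 2) ω M] (hS : IsOrientedSurface x N) (hx : ContMDiff (𝓡 2) 𝓘(ℝ, Mink) ω x)
    (hN : ContMDiff (𝓡 2) 𝓘(ℝ, Mink) ω N) {c : ℝ} {p : M}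
    (hp : ∀ᶠ q in 𝓝 p, IsPrincipalCurvature x N q c) (q : M) : IsPrincipalCurvature x N q c := by
  refine forall_of_eventually_of_analytic (fun e he => ?_) hp q
  refine ⟨charPencil (x ∘ e.symm) (N ∘ e.symm) c, (contDiffOn_charPencil e.open_target
    (contDiffOn_comp_symm hx he) (contDiffOn_comp_symm hN he) c).analyticOnNhd_of_isOpen
      e.open_target, fun u hu => ?_⟩
  rw [hS.isPrincipalCurvature_iff he (e.map_target hu), e.right_inv hu,
    (hS.patch he).hasCurvature_iff hu]

/-- Tangency of one fixed Killing field is an analytic equation in `x` and `N`. It is this equation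
that is continued, rather than the constancy of the lines of axes, which is only known near `p`. -/
theorem mink_contract_of_eventually {M : Type*} [TopologicalSpace M] [ChartedSpace Plane M]
    {x N : M → Mink} [PreconnectedSpace M]
    [IsManifold (𝓡 2) ω M] (hx : ContMDiff (𝓡 2) 𝓘(ℝ, Mink) ω x)
    (hN : ContMDiff (𝓡 2) 𝓘(ℝ, Mink) ω N) {β : Bivector} {p : M}
    (hp : ∀ᶠ q in 𝓝 p, mink (contract β (x q)) (N q) = 0) (q : M) :
    mink (contract β (x q)) (N q) = 0 := by
  refine forall_of_eventually_of_analytic (P := fun q => mink (contract β (x q)) (N q) = 0)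
    (fun e he => ?_) hp q
  refine ⟨fun u => mink (contractL β ((x ∘ e.symm) u)) ((N ∘ e.symm) u),
    ContDiffOn.analyticOnNhd_of_isOpen e.open_target ?_, fun u _ => Iff.rfl⟩
  exact ((contractL β).contDiff.comp_contDiffOn (contDiffOn_comp_symm hx he)).mink
    (contDiffOn_comp_symm hN he)

/-- The lines of axes agree on the connected set `V`, so one bivector chosen at `p` generates a
group whose Killing field is tangent at all points of `V`. -/
theorem IsCurvaturePair.isSurfaceOfRevolution_of_constLocus (hP : IsCurvaturePair x N k l)
    (hS : IsOrientedSurface x N) {V : Set M} (hV : IsOpen V) (hVc : IsPreconnected V)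
    {p : M} (hp : p ∈ V) (hsub : V ⊆ constLocus (axisLine x N k l)) :
    IsSurfaceOfRevolution x V := by
  obtain ⟨β, hβ⟩ := hP.exists_mem_axisLine hS p
  refine hP.isSurfaceOfRevolution hS hβ hV fun q hq => hP.mink_contract_eq_zero hS ?_
  rwa [← eq_of_subset_constLocus hVc hsub hp hq]

theorem IsCurvaturePair.isSurfaceOfRevolution_univ [PreconnectedSpace M] [IsManifold (𝓡 2) ω M]
    (hP : IsCurvaturePair x N k l) (hS : IsOrientedSurface x N)
    (hx : ContMDiff (𝓡 2) 𝓘(ℝ, Mink) ω x) (hN : ContMDiff (𝓡 2) 𝓘(ℝ, Mink) ω N) {p : M}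
    (hp : p ∈ constLocus (axisLine x N k l)) : IsSurfaceOfRevolution x univ := by
  obtain ⟨β, hβ⟩ := hP.exists_mem_axisLine hS p
  refine hP.isSurfaceOfRevolution hS hβ isOpen_univ fun q _ =>
    mink_contract_of_eventually hx hN (p := p) ?_ q
  have hp' : ∀ᶠ q in 𝓝 p, axisLine x N k l q = axisLine x N k l p := hp
  filter_upwards [hp'] with r hr
  exact hP.mink_contract_eq_zero hS (by rwa [hr])

end Surfaces

theorem proposition11 {M : Type*} [TopologicalSpace M] [ChartedSpace Plane M]
    [IsManifold (𝓡 2) ∞ M] (x N : M → Mink) (hS : IsOrientedSurface x N)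
    (hW : IsWeingarten x N) (hT : IsMarginallyTrapped (normalGeodesics x N)) :
    (∃ W : Set M, IsOpen W ∧ Dense W ∧ ∀ p ∈ W,
      HasConstantPrincipalCurvature x N (connectedComponentIn W p) ∨
        IsSurfaceOfRevolution x (connectedComponentIn W p)) ∧
    (PreconnectedSpace M → IsManifold (𝓡 2) ω M →
      ContMDiff (𝓡 2) 𝓘(ℝ, Mink) ω x → ContMDiff (𝓡 2) 𝓘(ℝ, Mink) ω N →
      HasConstantPrincipalCurvature x N univ ∨ IsSurfaceOfRevolution x univ) := by
  have hP := hS.isCurvaturePair hT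
  have hdense := hS.dense_constLocus hW hT
  have hmm := hS.isPrincipalCurvature_min_max hT
  constructor
  · obtain ⟨W, hWo, hWd, hWc⟩ := exists_dense_components _
      (fun i => by fin_cases i <;> exact isOpen_constLocus _) hdense
    refine ⟨W, hWo, hWd, fun p hp => ?_⟩
    -- Local connectedness makes the components of the open set `W` open, as needed for orbits to
    -- stay in them for small times.
    have : LocallyConnectedSpace M := ChartedSpace.locallyConnectedSpace Plane M
    have hVo : IsOpen (connectedComponentIn W p) := hWo.connectedComponentIn
    have hVc : IsPreconnected (connectedComponentIn W p) := isPreconnected_connectedComponentIn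
    have hpV := mem_connectedComponentIn hp
    obtain ⟨i, hi⟩ := hWc p hp
    fin_cases i
    · refine Or.inl ⟨minCurvature x N p, fun q hq => ?_⟩
      rw [eq_of_subset_constLocus hVc hi hpV hq]
      exact (hmm q).1
    · refine Or.inl ⟨maxCurvature x N p, fun q hq => ?_⟩
      rw [eq_of_subset_constLocus hVc hi hpV hq]
      exact (hmm q).2
    · exact Or.inr (hP.isSurfaceOfRevolution_of_constLocus hS hVo hVc hpV hi)
    · exact Or.inr (hP.swap.isSurfaceOfRevolution_of_constLocus hS hVo hVc hpV hi)
  · intro _ _ hx hN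
    -- `PreconnectedSpace` admits the empty surface, for which any constant serves.
    rcases isEmpty_or_nonempty M with hM | hM
    · exact Or.inl ⟨0, fun p _ => isEmptyElim p⟩
    obtain ⟨p, hp⟩ := hdense.nonempty
    obtain ⟨i, hi⟩ := mem_iUnion.mp hp
    fin_cases i
    · have hi' : ∀ᶠ q in 𝓝 p, minCurvature x N q = minCurvature x N p := hi
      refine Or.inl ⟨minCurvature x N p, fun q _ =>
        hS.isPrincipalCurvature_of_eventually hx hN (p := p) ?_ q⟩
      filter_upwards [hi'] with r hr
      exact hr ▸ (hmm r).1
    · have hi' : ∀ᶠ q in 𝓝 p, maxCurvature x N q = maxCurvature x N p := hi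
      refine Or.inl ⟨maxCurvature x N p, fun q _ =>
        hS.isPrincipalCurvature_of_eventually hx hN (p := p) ?_ q⟩
      filter_upwards [hi'] with r hr
      exact hr ▸ (hmm r).2
    · exact Or.inr (hP.isSurfaceOfRevolution_univ hS hx hN hi)
    · exact Or.inr (hP.swap.isSurfaceOfRevolution_univ hS hx hN hi)
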